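/- Let $\mathrm{MSO}_1$ be monadic second-order logic of finite simple graphs, with the atoms $\mathrm{edge}(x,y)$, $x=y$, $x\in X$ and quantification over vertices and over sets of vertices. A graph is a \emph{unit interval graph} if each vertex $v$ can be assigned a real interval $[\ell(v),\ell(v)+1)$ so that distinct vertices are adjacent if and only if their intervals intersect. Consider the parameterized problem \emph{$\mathrm{MSO}_1$ model checking on unit interval graphs}: the input is a unit interval graph $G$ (given by its adjacency matrix) and an $\mathrm{MSO}_1$ sentence $\varphi$, the parameter is the length of $\varphi$, and the question is whether $G\models\varphi$. \textbf{Corollary.} $\mathrm{MSO}_1$ model checking on unit interval graphs is $\mathrm{W}[2]$-hard. That is, every parameterized problem in $\mathrm{W}[2]$ has an fpt-reduction to it. Here an fpt-reduction maps instances to instances, preserves the answer, raises the parameter $k$ to at most $g(k)$, and is computed by a Turing machine in time at most $f(k)\,(|x|+1)^{c}$ on an input $x$ with parameter $k$, where $f,g$ are computable and $c$ is a constant. The class $\mathrm{W}[2]$ consists of the parameterized problems that, for some constant $h$, are fpt-reducible to the following problem: given a Boolean circuit $C$ with one output, of depth at most $h$ and weft at most $2$ (every path to the output has at most two gates of fan-in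 more than two), and a parameter $k$, does some assignment that sets exactly $k$ inputs of $C$ to true satisfy $C$? -/

import Mathlib

/-! ### Strings -/

namespace ParamComplexity

/-- A list of natural numbers as a bit string: each number in unary, ended by `false`. -/
def unary (l : List ℕ) : List Bool :=
  l.flatMap fun n => List.replicate n true ++ [false]

theorem replicate_append_inj {a b : ℕ} {r s : List Bool}
    (h : List.replicate a true ++ false :: r = List.replicate b true ++ false :: s) :
    a = b ∧ r = s := by
  induction a generalizing b with
  | zero => cases b <;> simp_all [List.replicate_succ]
  | succ a ih =>
    cases b with
    | zero => simp [List.replicate_succ] at h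
    | succ b =>
      simp only [List.replicate_succ, List.cons_append, List.cons.injEq, true_and] at h
      obtain ⟨h1, h2⟩ := ih h
      exact ⟨by rw [h1], h2⟩

theorem unary_injective : Function.Injective unary := by
  intro l
  induction l with
  | nil => intro l' h; cases l' <;> simp_all [unary]
  | cons a l ih =>
    intro l' h
    cases l' with
    | nil => simp [unary] at h
    | cons b l' =>
      simp only [unary, List.flatMap_cons, List.append_assoc, List.singleton_append] at h
      obtain ⟨h1, h2⟩ := replicate_append_inj h
      rw [h1, ih h2]

theorem flatMap_prefix_inj {α : Type} {c : α → List ℕ} {f g : ℕ → α}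
    (hc : ∀ i r s, c (f i) ++ r = c (g i) ++ s → f i = g i ∧ r = s) :
    ∀ (l : List ℕ) (r s : List ℕ),
      l.flatMap (fun i => c (f i)) ++ r = l.flatMap (fun i => c (g i)) ++ s →
      (∀ i ∈ l, f i = g i) ∧ r = s := by
  intro l
  induction l with
  | nil => intro r s h; simpa using h
  | cons a l ih =>
    intro r s h
    simp only [List.flatMap_cons, List.append_assoc] at h
    obtain ⟨h1, h2⟩ := hc _ _ _ h
    obtain ⟨h3, h4⟩ := ih _ _ h2
    exact ⟨by simpa using ⟨h1, h3⟩, h4⟩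

/-! ### Parameterized problems and fpt-reductions -/

/-- A parameterized decision problem: instances, written as bit strings, each with a
parameter and a yes/no answer. Only the instances in `Inst` are admissible inputs. -/
structure ParamProblem where
  Inst : Type
  encode : Inst → List Bool
  encode_injective : Function.Injective encode
  param : Inst → ℕ
  Yes : Inst → Prop

/-- `P` is fpt-reducible to `Q`: some map of instances preserves the answer, increases the
parameter by at most a computable function, and is computed by a single (multi-stack) Turing
machine in time `f(k) * (|x| + 1) ^ c`, where `k` is the parameter of the input, `|x|` is its
length, `f` is computable and `c` is a constant. -/
def FPTReducible (P Q : ParamProblem) : Prop :=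
  ∃ (r : P.Inst → Q.Inst) (M : Turing.TM2ComputableAux Bool Bool) (f g : ℕ → ℕ) (c : ℕ),
    Computable f ∧ Computable g ∧
    (∀ x, Nonempty (Turing.TM2OutputsInTime M.tm
      ((P.encode x).map M.inputAlphabet.invFun)
      (some ((Q.encode (r x)).map M.outputAlphabet.invFun))
      (f (P.param x) * ((P.encode x).length + 1) ^ c))) ∧
    (∀ x, Q.param (r x) ≤ g (P.param x)) ∧
    (∀ x, P.Yes x ↔ Q.Yes (r x))

/-! ### Boolean circuits and the W-hierarchy -/

/-- The gate at position `i` of a Boolean circuit; its arguments are gates at positions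
smaller than `i`. An `and` (`or`) gate without arguments is the constant true (false). -/
inductive Gate (i : ℕ) : Type
  | input : Gate i
  | neg (a : Fin i) : Gate i
  | and (as : List (Fin i)) : Gate i
  | or (as : List (Fin i)) : Gate i

/-- A Boolean decision circuit (acyclic, with one output gate), its gates listed in
topological order. -/
structure Circuit where
  size : ℕ
  gate : (i : Fin size) → Gate i
  out : Fin size

namespace Circuit

/-- The gate `i` evaluates to true if exactly the input gates in `S` are set to true. -/
def value (C : Circuit) (S : Finset (Fin C.size)) (i : Fin C.size) : Prop :=
  match C.gate i with
  | .input => i ∈ S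
  | .neg a => ¬ C.value S ⟨a, a.2.trans i.2⟩
  | .and as => ∀ a ∈ as, C.value S ⟨a, a.2.trans i.2⟩
  | .or as => ∃ a ∈ as, C.value S ⟨a, a.2.trans i.2⟩
termination_by i.val

/-- The largest number of non-input gates on a path that ends in the gate `i`. -/
def depthAt (C : Circuit) (i : Fin C.size) : ℕ :=
  match C.gate i with
  | .input => 0
  | .neg a => C.depthAt ⟨a, a.2.trans i.2⟩ + 1
  | .and as => (as.map fun a : Fin i => C.depthAt ⟨a, a.2.trans i.2⟩).foldr max 0 + 1
  | .or as => (as.map fun a : Fin i => C.depthAt ⟨a, a.2.trans i.2⟩).foldr max 0 + 1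
termination_by i.val

/-- The largest number of large gates, i.e. gates of fan-in more than two, on a path that
ends in the gate `i`. -/
def weftAt (C : Circuit) (i : Fin C.size) : ℕ :=
  match C.gate i with
  | .input => 0
  | .neg a => C.weftAt ⟨a, a.2.trans i.2⟩
  | .and as => (as.map fun a : Fin i => C.weftAt ⟨a, a.2.trans i.2⟩).foldr max 0 +
      if 2 < as.length then 1 else 0
  | .or as => (as.map fun a : Fin i => C.weftAt ⟨a, a.2.trans i.2⟩).foldr max 0 +
      if 2 < as.length then 1 else 0
termination_by i.val

def depth (C : Circuit) : ℕ := C.depthAt C.out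

def weft (C : Circuit) : ℕ := C.weftAt C.out

/-- Some assignment that sets exactly `k` input gates to true satisfies the circuit. -/
def HasSatWeight (C : Circuit) (k : ℕ) : Prop :=
  ∃ S : Finset (Fin C.size),
    (∀ i ∈ S, C.gate i = .input) ∧ S.card = k ∧ C.value S C.out

end Circuit

def Gate.code {i : ℕ} : Gate i → List ℕ
  | .input => [0]
  | .neg a => [1, a]
  | .and as => 2 :: as.length :: as.map Fin.val
  | .or as => 3 :: as.length :: as.map Fin.val

def Circuit.code (C : Circuit) : List ℕ :=
  C.size :: C.out :: (List.finRange C.size).flatMap fun i => (C.gate i).code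

theorem Gate.code_prefix {i : ℕ} (p q : Gate i) (r s : List ℕ)
    (h : p.code ++ r = q.code ++ s) : p = q ∧ r = s := by
  have key : ∀ (as bs : List (Fin i)), as.length = bs.length →
      as.map Fin.val ++ r = bs.map Fin.val ++ s → as = bs ∧ r = s := by
    intro as bs hl h
    obtain ⟨h1, h2⟩ := List.append_inj h (by simpa using hl)
    exact ⟨List.map_injective_iff.2 Fin.val_injective h1, h2⟩
  cases p <;> cases q <;>
    simp only [Gate.code, List.cons_append, List.nil_append, List.cons.injEq,
      OfNat.ofNat_ne_zero, OfNat.zero_ne_ofNat, OfNat.ofNat_ne_one, OfNat.one_ne_ofNat,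
      Nat.reduceEqDiff, zero_ne_one, one_ne_zero, false_and, true_and] at h ⊢
  · exact h
  · exact ⟨congrArg _ (Fin.ext h.1), h.2⟩
  · obtain ⟨h1, h2⟩ := key _ _ h.1 h.2
    exact ⟨congrArg _ h1, h2⟩
  · obtain ⟨h1, h2⟩ := key _ _ h.1 h.2
    exact ⟨congrArg _ h1, h2⟩

theorem Circuit.code_injective : Function.Injective Circuit.code := by
  rintro ⟨n, g, o⟩ ⟨n', g', o'⟩ h
  simp only [Circuit.code, List.cons.injEq] at h
  obtain ⟨rfl, h2, h3⟩ := h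
  obtain rfl : o = o' := Fin.ext h2
  have aux : ∀ (l : List (Fin n)),
      l.flatMap (fun i => (g i).code) = l.flatMap (fun i => (g' i).code) →
      ∀ i ∈ l, g i = g' i := by
    intro l
    induction l with
    | nil => simp
    | cons a l ih =>
      intro h
      simp only [List.flatMap_cons] at h
      obtain ⟨h1, h2⟩ := Gate.code_prefix _ _ _ _ h
      simpa using ⟨h1, ih h2⟩
  have : g = g' := funext fun i => aux _ h3 i (List.mem_finRange i)
  rw [this]

/-- An instance of weighted circuit satisfiability for circuits of weft at most `t` and
depth at most `h`. -/
structure WCSInst (t h : ℕ) where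
  circuit : Circuit
  weight : ℕ
  weft_le : circuit.weft ≤ t
  depth_le : circuit.depth ≤ h

/-- Weighted circuit satisfiability for circuits of weft at most `t` and depth at most `h`,
parameterized by the weight. -/
def WCS (t h : ℕ) : ParamProblem where
  Inst := WCSInst t h
  encode x := unary (x.weight :: x.circuit.code)
  encode_injective := by
    rintro ⟨C, k, _, _⟩ ⟨C', k', _, _⟩ hx
    have hx := unary_injective hx
    simp only [List.cons.injEq] at hx
    obtain ⟨rfl, h2⟩ := hx
    obtain rfl := Circuit.code_injective h2
    rfl
  param x := x.weight
  Yes x := x.circuit.HasSatWeight x.weight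

/-- Membership in the class `W[t]`. -/
def InW (t : ℕ) (P : ParamProblem) : Prop :=
  ∃ h : ℕ, FPTReducible P (WCS t h)

/-- `W[t]`-hardness (under fpt-reductions). -/
def WHard (t : ℕ) (P : ParamProblem) : Prop :=
  ∀ Q : ParamProblem, InW t Q → FPTReducible Q P

/-! ### The logic `MSO₁` of graphs -/

/-- `MSO₁` formulas of graphs with free vertex variables `0, …, n - 1` and free vertex set
variables `0, …, m - 1`. A quantifier binds the variable `n` (or `m`) of its body. -/
inductive MSO₁ : ℕ → ℕ → Type
  | edge {n m : ℕ} (x y : Fin n) : MSO₁ n m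
  | eq {n m : ℕ} (x y : Fin n) : MSO₁ n m
  | mem {n m : ℕ} (x : Fin n) (X : Fin m) : MSO₁ n m
  | neg {n m : ℕ} (φ : MSO₁ n m) : MSO₁ n m
  | and {n m : ℕ} (φ ψ : MSO₁ n m) : MSO₁ n m
  | or {n m : ℕ} (φ ψ : MSO₁ n m) : MSO₁ n m
  | exVertex {n m : ℕ} (φ : MSO₁ (n + 1) m) : MSO₁ n m
  | allVertex {n m : ℕ} (φ : MSO₁ (n + 1) m) : MSO₁ n m
  | exSet {n m : ℕ} (φ : MSO₁ n (m + 1)) : MSO₁ n m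
  | allSet {n m : ℕ} (φ : MSO₁ n (m + 1)) : MSO₁ n m

/-- Satisfaction in the graph `G`, with `v` and `S` the values of the free variables. -/
def MSO₁.Sat {V : Type*} (G : SimpleGraph V) :
    {n m : ℕ} → MSO₁ n m → (Fin n → V) → (Fin m → Set V) → Prop
  | _, _, .edge x y, v, _ => G.Adj (v x) (v y)
  | _, _, .eq x y, v, _ => v x = v y
  | _, _, .mem x X, v, S => v x ∈ S X
  | _, _, .neg φ, v, S => ¬ φ.Sat G v S
  | _, _, .and φ ψ, v, S => φ.Sat G v S ∧ ψ.Sat G v S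
  | _, _, .or φ ψ, v, S => φ.Sat G v S ∨ ψ.Sat G v S
  | _, _, .exVertex φ, v, S => ∃ a : V, φ.Sat G (Fin.snoc v a) S
  | _, _, .allVertex φ, v, S => ∀ a : V, φ.Sat G (Fin.snoc v a) S
  | _, _, .exSet φ, v, S => ∃ A : Set V, φ.Sat G v (Fin.snoc S A)
  | _, _, .allSet φ, v, S => ∀ A : Set V, φ.Sat G v (Fin.snoc S A)

/-- Sentences: formulas without free variables. -/
abbrev MSO₁Sentence : Type := MSO₁ 0 0

/-- `G ⊨ φ`. -/
def Models {V : Type*} (G : SimpleGraph V) (φ : MSO₁Sentence) : Prop :=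
  φ.Sat G Fin.elim0 Fin.elim0

/-- A formula as a list of numbers, in prefix notation. -/
def MSO₁.code : {n m : ℕ} → MSO₁ n m → List ℕ
  | _, _, .edge x y => [0, x, y]
  | _, _, .eq x y => [1, x, y]
  | _, _, .mem x X => [2, x, X]
  | _, _, .neg φ => 3 :: φ.code
  | _, _, .and φ ψ => 4 :: (φ.code ++ ψ.code)
  | _, _, .or φ ψ => 5 :: (φ.code ++ ψ.code)
  | _, _, .exVertex φ => 6 :: φ.code
  | _, _, .allVertex φ => 7 :: φ.code
  | _, _, .exSet φ => 8 :: φ.code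
  | _, _, .allSet φ => 9 :: φ.code

/-- The length of a formula, written as a bit string. -/
def MSO₁.length {n m : ℕ} (φ : MSO₁ n m) : ℕ := (unary φ.code).length

theorem MSO₁.code_prefix {n m : ℕ} (φ ψ : MSO₁ n m) (r s : List ℕ)
    (h : φ.code ++ r = ψ.code ++ s) : φ = ψ ∧ r = s := by
  induction φ generalizing r s with
  | edge x y =>
    cases ψ <;> simp [MSO₁.code, Fin.val_inj] at h ⊢
    tauto
  | eq x y =>
    cases ψ <;> simp [MSO₁.code, Fin.val_inj] at h ⊢
    tauto
  | mem x X =>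
    cases ψ <;> simp [MSO₁.code, Fin.val_inj] at h ⊢
    tauto
  | neg φ ih =>
    cases ψ <;> simp [MSO₁.code] at h ⊢
    exact ih _ _ _ h
  | and φ φ' ih ih' =>
    cases ψ <;> simp [MSO₁.code] at h ⊢
    obtain ⟨h1, h2⟩ := ih _ _ _ h
    obtain ⟨h3, h4⟩ := ih' _ _ _ h2
    exact ⟨⟨h1, h3⟩, h4⟩
  | or φ φ' ih ih' =>
    cases ψ <;> simp [MSO₁.code] at h ⊢
    obtain ⟨h1, h2⟩ := ih _ _ _ h
    obtain ⟨h3, h4⟩ := ih' _ _ _ h2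
    exact ⟨⟨h1, h3⟩, h4⟩
  | exVertex φ ih =>
    cases ψ <;> simp [MSO₁.code] at h ⊢
    exact ih _ _ _ h
  | allVertex φ ih =>
    cases ψ <;> simp [MSO₁.code] at h ⊢
    exact ih _ _ _ h
  | exSet φ ih =>
    cases ψ <;> simp [MSO₁.code] at h ⊢
    exact ih _ _ _ h
  | allSet φ ih =>
    cases ψ <;> simp [MSO₁.code] at h ⊢
    exact ih _ _ _ h

/-! ### Graphs and model checking -/

/-- `G` is an `L`-interval graph: the intersection graph of half-open intervals `[ℓ v, r v)`
with lengths in `L`. -/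
def IsIntervalGraph (L : Set ℝ) {V : Type*} (G : SimpleGraph V) : Prop :=
  ∃ ℓ r : V → ℝ, (∀ v, r v - ℓ v ∈ L) ∧
    ∀ u v, u ≠ v → (G.Adj u v ↔ (Set.Ico (ℓ u) (r u) ∩ Set.Ico (ℓ v) (r v)).Nonempty)

/-- Unit interval graphs. -/
def IsUnitIntervalGraph {V : Type*} (G : SimpleGraph V) : Prop :=
  IsIntervalGraph {1} G

open Classical in
/-- The number of vertices, followed by the rows of the adjacency matrix. -/
noncomputable def graphCode {n : ℕ} (G : SimpleGraph (Fin n)) : List ℕ :=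
  n :: (List.finRange n).flatMap fun i =>
    (List.finRange n).map fun j => if G.Adj i j then 1 else 0

theorem graphCode_prefix {n n' : ℕ} (G : SimpleGraph (Fin n)) (G' : SimpleGraph (Fin n'))
    (r s : List ℕ) (h : graphCode G ++ r = graphCode G' ++ s) :
    (⟨n, G⟩ : Σ n, SimpleGraph (Fin n)) = ⟨n', G'⟩ ∧ r = s := by
  classical
  simp only [graphCode, List.cons_append, List.cons.injEq] at h
  obtain ⟨rfl, h⟩ := h
  obtain ⟨h1, h2⟩ := List.append_inj h (by simp)
  refine ⟨?_, h2⟩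
  have aux : ∀ (l : List (Fin n)),
      (l.flatMap fun i => (List.finRange n).map fun j => if G.Adj i j then 1 else 0) =
      (l.flatMap fun i => (List.finRange n).map fun j => if G'.Adj i j then 1 else 0) →
      ∀ i ∈ l, ∀ j, G.Adj i j ↔ G'.Adj i j := by
    intro l
    induction l with
    | nil => simp
    | cons a l ih =>
      intro h
      simp only [List.flatMap_cons] at h
      obtain ⟨h1, h2⟩ := List.append_inj h (by simp)
      have h3 : ∀ j, G.Adj a j ↔ G'.Adj a j := by
        intro j
        have := List.map_inj_left.1 h1 j (List.mem_finRange j)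
        by_cases hg : G.Adj a j <;> by_cases hg' : G'.Adj a j <;> simp_all
      simpa using ⟨h3, ih h2⟩
  have : G = G' := by
    ext i j
    exact aux _ (by convert h1) i (List.mem_finRange i) j
  rw [this]

/-- A class of finite graphs. -/
abbrev GraphClass : Type := (n : ℕ) → SimpleGraph (Fin n) → Prop

/-- An instance of `MSO₁` model checking on the graph class `𝒞`. -/
structure MCInst (𝒞 : GraphClass) where
  order : ℕ
  graph : SimpleGraph (Fin order)
  graph_mem : 𝒞 order graph
  sentence : MSO₁Sentence

/-- `MSO₁` model checking on the graph class `𝒞`: given a graph `G` in `𝒞` and an `MSO₁`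
sentence `φ`, decide whether `G ⊨ φ`. The parameter is the length of `φ`. -/
noncomputable def MSO₁ModelChecking (𝒞 : GraphClass) : ParamProblem where
  Inst := MCInst 𝒞
  encode x := unary (graphCode x.graph ++ x.sentence.code)
  encode_injective := by
    rintro ⟨n, G, hG, φ⟩ ⟨n', G', hG', φ'⟩ hx
    obtain ⟨h1, h2⟩ := graphCode_prefix _ _ _ _ (unary_injective hx)
    obtain ⟨rfl, h1⟩ := Sigma.mk.inj_iff.1 h1
    obtain rfl := eq_of_heq h1
    obtain ⟨rfl, -⟩ := MSO₁.code_prefix φ φ' [] [] (by simpa using h2)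
    rfl
  param x := x.sentence.length
  Yes x := Models x.graph x.sentence

/-- The class of unit interval graphs. -/
def unitIntervalGraphs : GraphClass := fun _ G => IsUnitIntervalGraph G

end ParamComplexity

/-!
Weighted circuit satisfiability reduces to model checking a single fixed `MSO₁` sentence on unit
interval graphs, so the parameter of the produced instances is constant. Neither the bound on the
weft nor that on the depth of the circuits is needed.

**The graphs.** Vertices are placed at the positions `0, …, M - 1` of a line, and distinct vertices
are adjacent if their positions differ by less than `D` (`nearGraph`, a unit interval graph). Each
position carries one vertex, or two if the position is marked. For `2 * D ≤ M`, two vertices share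
their position if and only if they have the same closed neighbourhood. From this, `MSO₁` formulas
define "next position", "`D` positions further" and "marked" (`MSO₁.sat_next`, `MSO₁.sat_shifted`,
`MSO₁.sat_marked`). The positions thus form a grid whose columns have height `D`, where the last
row of a column is followed by the first row of the next one. Set quantifiers guess labels of the
positions, and so a sentence can say that the line has a labelling by a finite set of labels that
satisfies given local constraints (`Constraints.exists_sentence`).

**The reader.** A machine with finite control and a few counters reads the code of a circuit and
checks, for a guessed assignment of truth values to all gates, that each gate has the value
determined by its arguments, that the output is true, and that exactly `k` inputs are true
(`Circuit.exists_accepts_iff`). The counters, and the guessed values, are held on a tape of length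
`D`, with a counter value as the position of a symbol, so that all that happens when a bit is read
is done in one sweep over the tape. A column of the grid is one such sweep, and the bit that is
read in it is given by the mark of its first position. Hence valid labellings correspond to
accepting runs (`exists_valid_sweepConstraints_iff`).

**The machine.** A reduction to weighted circuit satisfiability is computed by a `FinTM2`. Its
output is turned into the adjacency matrix of the graph by a further program on stacks. Such a
program is compiled into a machine that takes over where the first one halts (`progMachine`). The
matrix is printed row by row: a window that slides along the line tells how near each position is
to that of the current row (`does_printMatrix`). The running time of the program is polynomial in
the length of the output of the first machine, which is at most linear in its input length and
running time (`exists_length_output_le`).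
-/

namespace ParamComplexity

open Turing Function

/-! ### Unit interval graphs on a line of positions -/

/-- The graph whose vertices `v` are placed at the positions `pos v`, with distinct vertices
adjacent if their positions differ by less than `D`. -/
def nearGraph (D : ℕ) {n : ℕ} (pos : Fin n → ℕ) : SimpleGraph (Fin n) where
  Adj u v := u ≠ v ∧ pos u < pos v + D ∧ pos v < pos u + D
  symm := ⟨fun _ _ h => ⟨h.1.symm, h.2.2, h.2.1⟩⟩
  loopless := ⟨fun _ h => h.1 rfl⟩

theorem isUnitIntervalGraph_nearGraph {D n : ℕ} (hD : 0 < D) (pos : Fin n → ℕ) :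
    IsUnitIntervalGraph (nearGraph D pos) := by
  have hD' : (0 : ℝ) < D := by exact_mod_cast hD
  refine ⟨fun v => pos v / D, fun v => pos v / D + 1, fun v => by simp, fun u v huv => ?_⟩
  have key : ∀ u v : Fin n, pos u < pos v + D ↔ (pos u / D : ℝ) < pos v / D + 1 := by
    intro u v
    rw [div_add_one hD'.ne', div_lt_div_iff_of_pos_right hD']
    exact_mod_cast Iff.rfl
  simp only [nearGraph, key, huv, ne_eq, not_false_eq_true, true_and, Set.Ico_inter_Ico,
    Set.nonempty_Ico, sup_lt_iff, lt_inf_iff]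
  constructor
  · rintro ⟨h1, h2⟩
    exact ⟨⟨by linarith, h2⟩, h1, by linarith⟩
  · rintro ⟨⟨_, h2⟩, h1, _⟩
    exact ⟨h1, h2⟩

/-- The vertices cover exactly the positions below `M`, and `M` is large compared to the
distance `D` that adjacency can bridge. Exactly the positions in `mark` carry more than one vertex.
The first position is marked and the last one is not, which tells the two ends apart. -/
structure IsLayout (D M : ℕ) (mark : ℕ → Prop) {n : ℕ} (pos : Fin n → ℕ) : Prop where
  one_lt : 1 < D
  two_mul_le : 2 * D ≤ M
  pos_lt : ∀ v, pos v < M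
  surj : ∀ q < M, ∃ v, pos v = q
  mark_iff : ∀ v, mark (pos v) ↔ ∃ u, u ≠ v ∧ pos u = pos v
  mark_zero : mark 0
  not_mark_last : ¬ mark (M - 1)

namespace MSO₁

variable {n m : ℕ}

def impl (φ ψ : MSO₁ n m) : MSO₁ n m := .or (.neg φ) ψ

/-- The vertices are equal or adjacent. -/
def near (x y : Fin n) : MSO₁ n m := .or (.eq x y) (.edge x y)

/-- The vertices have the same closed neighbourhood. -/
def twin (x y : Fin n) : MSO₁ n m :=
  .allVertex (.and (impl (near (.last n) x.castSucc) (near (.last n) y.castSucc))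
    (impl (near (.last n) y.castSucc) (near (.last n) x.castSucc)))

/-- The vertices near `y` that are not near `x` are twins of each other. -/
def oneNew (x y : Fin n) : MSO₁ n m :=
  .allVertex (.allVertex (impl
    (.and (.and (near (Fin.last n).castSucc y.castSucc.castSucc)
        (.neg (near (Fin.last n).castSucc x.castSucc.castSucc)))
      (.and (near (Fin.last (n + 1)) y.castSucc.castSucc)
        (.neg (near (Fin.last (n + 1)) x.castSucc.castSucc))))
    (twin (Fin.last n).castSucc (Fin.last (n + 1)))))

/-- The vertices are at consecutive positions: a move by one position brings at most one new
position near, while a longer move, or the move back, brings several near, as the two ends of the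
line are not both close. -/
def consec (x y : Fin n) : MSO₁ n m := .and (.neg (twin x y)) (.and (oneNew x y) (oneNew y x))

/-- The vertex shares its position with another vertex. -/
def marked (x : Fin n) : MSO₁ n m :=
  .exVertex (.and (.neg (.eq (.last n) x.castSucc)) (twin (.last n) x.castSucc))

/-- The vertex is at the marked end of the line: all positions consecutive to its own are equal. -/
def first (x : Fin n) : MSO₁ n m :=
  .and (marked x) (.allVertex (.allVertex (impl
    (.and (consec x.castSucc.castSucc (Fin.last n).castSucc)
      (consec x.castSucc.castSucc (Fin.last (n + 1))))
    (twin (Fin.last n).castSucc (Fin.last (n + 1))))))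

/-- The position of `y` comes next after that of `x`: some set of vertices contains `x` and the
first position and can be left only by a step from `x` to `y`. -/
def next (x y : Fin n) : MSO₁ n m :=
  .and (consec x y) (.exSet
    (.and (.and (.mem x (.last m)) (.neg (.mem y (.last m))))
      (.and (.allVertex (impl (first (.last n)) (.mem (.last n) (.last m))))
        (.allVertex (.allVertex (impl
          (.and
            (.and (.mem (Fin.last n).castSucc (.last m)) (.neg (.mem (.last (n + 1)) (.last m))))
            (consec (Fin.last n).castSucc (.last (n + 1))))
          (.and (twin (Fin.last n).castSucc x.castSucc.castSucc)
            (twin (.last (n + 1)) y.castSucc.castSucc))))))))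

/-- The position of `y` is the first one after `x` that is not near `x`. -/
def shifted (x y : Fin n) : MSO₁ n m :=
  .and (.neg (near x y)) (.exVertex (.and (next (.last n) y.castSucc) (near x.castSucc (.last n))))

section Semantics

variable {D M k : ℕ} {mark : ℕ → Prop} {pos : Fin k → ℕ} (h : IsLayout D M mark pos)
  (x y : Fin n) (v : Fin n → Fin k) (S : Fin m → Set (Fin k))

theorem sat_impl {V : Type} (G : SimpleGraph V) (φ ψ : MSO₁ n m) (v : Fin n → V)
    (S : Fin m → Set V) : (impl φ ψ).Sat G v S ↔ (φ.Sat G v S → ψ.Sat G v S) := by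
  simp [impl, Sat, imp_iff_not_or]

include h

theorem sat_near : (near x y).Sat (nearGraph D pos) v S ↔
    pos (v x) < pos (v y) + D ∧ pos (v y) < pos (v x) + D := by
  have := h.one_lt
  by_cases hxy : v x = v y
  · simp [near, Sat, hxy]; omega
  · simp [near, Sat, hxy, nearGraph]

theorem forall_vertex {P : ℕ → Prop} : (∀ v, P (pos v)) ↔ ∀ q < M, P q := by
  constructor
  · intro hP q hq
    obtain ⟨v, rfl⟩ := h.surj q hq
    exact hP v
  · exact fun hP v => hP _ (h.pos_lt v)

theorem exists_vertex {P : ℕ → Prop} : (∃ v, P (pos v)) ↔ ∃ q < M, P q := by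
  constructor
  · exact fun ⟨v, hv⟩ => ⟨_, h.pos_lt v, hv⟩
  · rintro ⟨q, hq, hP⟩
    obtain ⟨v, rfl⟩ := h.surj q hq
    exact ⟨v, hP⟩

/-- Vertices at different positions have different neighbourhoods: the line is so long that some
position is near to only one of them. -/
theorem sat_twin : (twin x y).Sat (nearGraph D pos) v S ↔ pos (v x) = pos (v y) := by
  have h1 := h.one_lt
  have h2 := h.two_mul_le
  have hx := h.pos_lt (v x)
  have hy := h.pos_lt (v y)
  simp only [twin, Sat, sat_impl, sat_near h, Fin.snoc_last, Fin.snoc_castSucc]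
  rw [forall_vertex h (P := fun q => (q < pos (v x) + D ∧ pos (v x) < q + D →
    q < pos (v y) + D ∧ pos (v y) < q + D) ∧ (q < pos (v y) + D ∧ pos (v y) < q + D →
    q < pos (v x) + D ∧ pos (v x) < q + D))]
  constructor
  · intro H
    have a1 := H (pos (v x) + D)
    have a2 := H (pos (v y) + D)
    have a3 := H (pos (v x) - D)
    have a4 := H (pos (v y) - D)
    have a5 := H (pos (v x))
    omega
  · intro H q _
    rw [H]; simp

theorem sat_oneNew : (oneNew x y).Sat (nearGraph D pos) v S ↔
    ∀ q < M, ∀ q' < M, (q < pos (v y) + D ∧ pos (v y) < q + D) →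
      ¬ (q < pos (v x) + D ∧ pos (v x) < q + D) → (q' < pos (v y) + D ∧ pos (v y) < q' + D) →
      ¬ (q' < pos (v x) + D ∧ pos (v x) < q' + D) → q = q' := by
  simp only [oneNew, Sat, sat_impl, sat_near h, sat_twin h, Fin.snoc_last, Fin.snoc_castSucc]
  simp only [and_imp (a := _ ∧ _)]
  constructor
  · intro H q hq q' hq'
    obtain ⟨u, rfl⟩ := h.surj q hq
    obtain ⟨u', rfl⟩ := h.surj q' hq'
    exact H u u'
  · intro H u u'
    exact H _ (h.pos_lt u) _ (h.pos_lt u')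

theorem sat_consec : (consec x y).Sat (nearGraph D pos) v S ↔
    pos (v y) = pos (v x) + 1 ∨ pos (v x) = pos (v y) + 1 := by
  have h1 := h.one_lt
  have h2 := h.two_mul_le
  have hx := h.pos_lt (v x)
  have hy := h.pos_lt (v y)
  simp only [consec, Sat, sat_twin h, sat_oneNew h]
  generalize pos (v x) = p at *
  generalize pos (v y) = q at *
  constructor
  · rintro ⟨H0, H1, H2⟩
    by_cases c : p < q
    · by_cases c0 : p + D < q
      · have := H1 q hy (q - 1) (by omega)
        omega
      · by_cases c1 : p + D + 1 < M
        · have := H1 (p + D) (by omega) (p + D + 1) (by omega)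
          omega
        · have := H2 (q - D) (by omega) (q - D - 1) (by omega)
          omega
    · by_cases c0 : q + D < p
      · have := H2 p hx (p - 1) (by omega)
        omega
      · by_cases c1 : q + D + 1 < M
        · have := H2 (q + D) (by omega) (q + D + 1) (by omega)
          omega
        · have := H1 (p - D) (by omega) (p - D - 1) (by omega)
          omega
  · intro H
    refine ⟨by omega, ?_, ?_⟩ <;> intros <;> omega

theorem sat_marked : (marked x).Sat (nearGraph D pos) v S ↔ mark (pos (v x)) := by
  simp only [marked, Sat, sat_twin h, Fin.snoc_last, Fin.snoc_castSucc, h.mark_iff, ne_eq]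

theorem sat_first : (first x).Sat (nearGraph D pos) v S ↔ pos (v x) = 0 := by
  have h1 := h.one_lt
  have h2 := h.two_mul_le
  have hx := h.pos_lt (v x)
  simp only [first, Sat, sat_marked h, sat_impl, sat_consec h, sat_twin h, Fin.snoc_last,
    Fin.snoc_castSucc]
  constructor
  · rintro ⟨H1, H2⟩
    by_contra hne
    have h3 : pos (v x) ≠ M - 1 := fun e => h.not_mark_last (e ▸ H1)
    obtain ⟨u, hu⟩ := h.surj (pos (v x) + 1) (by omega)
    obtain ⟨w, hw⟩ := h.surj (pos (v x) - 1) (by omega)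
    have := H2 u w
    omega
  · intro H
    rw [H]
    refine ⟨h.mark_zero, fun u w => ?_⟩
    omega

theorem sat_next : (next x y).Sat (nearGraph D pos) v S ↔ pos (v y) = pos (v x) + 1 := by
  simp only [next, Sat, sat_impl, sat_consec h, sat_first h, sat_twin h, Fin.snoc_last,
    Fin.snoc_castSucc]
  constructor
  · rintro ⟨H0, X, ⟨H1, H2⟩, H3, H4⟩
    rcases H0 with H0 | H0
    · exact H0
    exfalso
    -- A walk from the first position to `y` never comes to `x`, and so it stays inside `X`.
    have key : ∀ q ≤ pos (v y), ∀ u, pos u = q → u ∈ X := by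
      intro q
      induction q with
      | zero => exact fun _ u hu => H3 u hu
      | succ q ih =>
        intro hq w hw
        by_contra hwX
        have hlt := h.pos_lt (v y)
        obtain ⟨u, hu⟩ := h.surj q (by omega)
        have := H4 u w ⟨⟨ih (by omega) u hu, hwX⟩, by omega⟩
        omega
    exact H2 (key _ le_rfl _ rfl)
  · intro H
    refine ⟨Or.inl H, {u | pos u ≤ pos (v x)}, ⟨by simp, by simp; omega⟩,
      fun u hu => by simp [hu], fun u w => ?_⟩
    simp only [Set.mem_ofPred_eq]
    omega

theorem sat_shifted : (shifted x y).Sat (nearGraph D pos) v S ↔ pos (v y) = pos (v x) + D := by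
  have h1 := h.one_lt
  have hy := h.pos_lt (v y)
  simp only [shifted, Sat, sat_near h, sat_next h, Fin.snoc_last, Fin.snoc_castSucc]
  rw [exists_vertex h (P := fun q => pos (v y) = q + 1 ∧ (pos (v x) < q + D ∧ q < pos (v x) + D))]
  constructor
  · rintro ⟨H1, q, H2⟩
    omega
  · intro H
    exact ⟨by omega, pos (v y) - 1, by omega⟩

end Semantics

/-- Every Boolean combination of finitely many formulas is equivalent to a formula. -/
theorem exists_combination {ι : Type} [Finite ι] (φ : ι → MSO₁ n m) (F : (ι → Prop) → Prop) :
    ∃ ψ : MSO₁ n m, ∀ {V : Type} (G : SimpleGraph V) (v : Fin n → V) (S : Fin m → Set V),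
      ψ.Sat G v S ↔ F fun i => (φ i).Sat G v S := by
  have key : ∀ (s : ℕ) (φ : Fin s → MSO₁ n m) (F : (Fin s → Prop) → Prop),
      ∃ ψ : MSO₁ n m, ∀ {V : Type} (G : SimpleGraph V) (v : Fin n → V) (S : Fin m → Set V),
        ψ.Sat G v S ↔ F fun i => (φ i).Sat G v S := by
    intro s
    induction s with
    | zero =>
      intro φ F
      have taut : ∀ {V : Type} (G : SimpleGraph V) (v : Fin n → V) (S : Fin m → Set V),
          (MSO₁.allVertex (.eq (.last n) (.last n)) : MSO₁ n m).Sat G v S :=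
        fun G v S a => rfl
      by_cases hF : F Fin.elim0
      · refine ⟨_, fun G v S => iff_of_true (taut G v S) ?_⟩
        convert hF
      · refine ⟨.neg (.allVertex (.eq (.last n) (.last n))), fun G v S =>
          iff_of_false (fun h => h (taut G v S)) ?_⟩
        convert hF
    | succ s ih =>
      intro φ F
      obtain ⟨ψ, hψ⟩ := ih (fun i => φ i.succ) fun p => F (Fin.cons True p)
      obtain ⟨χ, hχ⟩ := ih (fun i => φ i.succ) fun p => F (Fin.cons False p)
      refine ⟨.or (.and (φ 0) ψ) (.and (.neg (φ 0)) χ), fun G v S => ?_⟩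
      simp only [Sat, hψ, hχ]
      have e : (fun i => (φ i).Sat G v S) =
          Fin.cons ((φ 0).Sat G v S) fun i => (φ i.succ).Sat G v S := by
        funext i
        cases i using Fin.cases <;> simp
      rw [e]
      by_cases h0 : (φ 0).Sat G v S <;> simp [h0]
  obtain ⟨s, ⟨e⟩⟩ := Finite.exists_equiv_fin ι
  obtain ⟨ψ, hψ⟩ := key s (fun i => φ (e.symm i)) fun p => F fun i => p (e i)
  exact ⟨ψ, fun G v S => by simp [hψ]⟩

/-- Quantification over a tuple of sets. -/
theorem exists_exSets (r : ℕ) (φ : MSO₁ n r) :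
    ∃ ψ : MSO₁ n 0, ∀ {V : Type} (G : SimpleGraph V) (v : Fin n → V),
      ψ.Sat G v Fin.elim0 ↔ ∃ S, φ.Sat G v S := by
  induction r with
  | zero =>
    refine ⟨φ, fun G v => ⟨fun h => ⟨_, h⟩, fun ⟨S, h⟩ => ?_⟩⟩
    rwa [Subsingleton.elim S Fin.elim0] at h
  | succ r ih =>
    obtain ⟨ψ, hψ⟩ := ih (.exSet φ)
    refine ⟨ψ, fun G v => (hψ G v).trans ⟨?_, ?_⟩⟩
    · rintro ⟨S, A, h⟩
      exact ⟨_, h⟩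
    · rintro ⟨S, h⟩
      refine ⟨Fin.init S, S (.last r), ?_⟩
      rwa [Fin.snoc_init_self]

end MSO₁

/-! ### Labellings with local constraints -/

/-- Local constraints for a labelling of positions. The label of the first position has to satisfy
`init₀`, that of any other position in the first column is related by `init` to the preceding one,
and each label after that is related by `step` to the preceding one, to the one that is one column
back, and to the mark of its own position. The last label has to be accepted. -/
structure Constraints (A : Type) where
  init₀ : A → Prop
  init : A → A → Prop
  step : A → A → Prop → A → Prop
  accept : A → Prop

/-- `μ` labels the positions below `M`, in columns of height `D` and with the given marks,
according to the constraints. -/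
structure Constraints.Valid {A : Type} (c : Constraints A) (D M : ℕ) (mark : ℕ → Prop)
    (μ : ℕ → A) : Prop where
  init₀ : c.init₀ (μ 0)
  init : ∀ q, q + 1 < D → c.init (μ q) (μ (q + 1))
  step : ∀ q, D ≤ q + 1 → q + 1 < M → c.step (μ q) (μ (q + 1 - D)) (mark (q + 1)) (μ (q + 1))
  accept : c.accept (μ (M - 1))

/-- The existence of a labelling with given local constraints is expressed by an `MSO₁` sentence:
each label is represented by the set of the vertices that carry it. -/
theorem Constraints.exists_sentence {A : Type} [Finite A] (c : Constraints A) :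
    ∃ φ : MSO₁Sentence, ∀ (n D M : ℕ) (mark : ℕ → Prop) (pos : Fin n → ℕ),
      IsLayout D M mark pos →
      (Models (nearGraph D pos) φ ↔ ∃ μ, c.Valid D M mark μ) := by
  obtain ⟨r, ⟨e⟩⟩ := Finite.exists_equiv_fin A
  let mems : Fin 3 × Fin r → MSO₁ 3 r := fun p => .mem p.1 p.2
  let atoms : Fin 7 → MSO₁ 3 r := ![.twin 0 1, .first 0, .next 1 0, .shifted 2 0, .marked 0,
    .exVertex (.shifted 3 0), .exVertex (.next 0 3)]
  obtain ⟨ψ, hψ⟩ := MSO₁.exists_combination (Sum.elim mems atoms) fun p => ∃ l : Fin 3 → A,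
    (∀ x i, p (.inl (x, i)) ↔ i = e (l x)) ∧
    (p (.inr 0) → l 0 = l 1) ∧ (p (.inr 1) → c.init₀ (l 0)) ∧
    (p (.inr 2) → ¬ p (.inr 5) → c.init (l 1) (l 0)) ∧
    (p (.inr 2) → p (.inr 3) → c.step (l 1) (l 2) (p (.inr 4)) (l 0)) ∧
    (¬ p (.inr 6) → c.accept (l 0))
  obtain ⟨φ, hφ⟩ := MSO₁.exists_exSets r (.allVertex (.allVertex (.allVertex ψ)) : MSO₁ 0 r)
  refine ⟨φ, fun n D M mark pos h => (hφ _ _).trans ?_⟩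
  have h1 := h.one_lt
  have h2 := h.two_mul_le
  have e3 : (3 : Fin 4) = Fin.last 3 := rfl
  have e0 : (0 : Fin 4) = Fin.castSucc (0 : Fin 3) := rfl
  -- The quantifier-free part of the sentence, evaluated at three vertices.
  have hsat : ∀ (S : Fin r → Set (Fin n)) (w : Fin 3 → Fin n), ψ.Sat (nearGraph D pos) w S ↔
      ∃ l : Fin 3 → A, (∀ x i, w x ∈ S i ↔ i = e (l x)) ∧
      (pos (w 0) = pos (w 1) → l 0 = l 1) ∧ (pos (w 0) = 0 → c.init₀ (l 0)) ∧
      (pos (w 0) = pos (w 1) + 1 → pos (w 0) < D → c.init (l 1) (l 0)) ∧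
      (pos (w 0) = pos (w 1) + 1 → pos (w 0) = pos (w 2) + D →
        c.step (l 1) (l 2) (mark (pos (w 0))) (l 0)) ∧
      (pos (w 0) = M - 1 → c.accept (l 0)) := by
    intro S w
    rw [hψ]
    have a5 : (∃ u, pos (w 0) = pos u + D) ↔ ¬ pos (w 0) < D := by
      constructor
      · rintro ⟨u, hu⟩; omega
      · intro hu
        have := h.pos_lt (w 0)
        obtain ⟨u, hu'⟩ := h.surj (pos (w 0) - D) (by omega)
        exact ⟨u, by omega⟩
    have a6 : (∃ u, pos u = pos (w 0) + 1) ↔ pos (w 0) ≠ M - 1 := by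
      have := h.pos_lt (w 0)
      constructor
      · rintro ⟨u, hu⟩
        have := h.pos_lt u
        omega
      · intro hu
        exact h.surj (pos (w 0) + 1) (by omega)
    simp only [Sum.elim_inl, Sum.elim_inr, mems, atoms, MSO₁.Sat, Matrix.cons_val,
      MSO₁.sat_twin h, MSO₁.sat_first h, MSO₁.sat_next h, MSO₁.sat_shifted h, MSO₁.sat_marked h,
      e3, e0, Fin.snoc_last, Fin.snoc_castSucc, a5, a6, not_not, ne_eq]
  have htriple : ∀ (S : Fin r → Set (Fin n)),
      (MSO₁.allVertex (.allVertex (.allVertex ψ)) : MSO₁ 0 r).Sat (nearGraph D pos) Fin.elim0 S ↔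
        ∀ x y z, ψ.Sat (nearGraph D pos) ![x, y, z] S := by
    intro S
    simp only [MSO₁.Sat]
    refine forall_congr' fun x => forall_congr' fun y => forall_congr' fun z => ?_
    have : (Fin.snoc (Fin.snoc (Fin.snoc Fin.elim0 x) y) z : Fin 3 → Fin n) = ![x, y, z] := by
      funext i
      fin_cases i <;> rfl
    rw [← this]
  simp only [htriple, hsat]
  simp only [Matrix.cons_val]
  constructor
  · rintro ⟨S, H⟩
    choose l hl using H
    -- Membership in the sets determines the label of a vertex.
    have huniq : ∀ x y z x' y' z' i j, (![x, y, z] i : Fin n) = ![x', y', z'] j →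
        l x y z i = l x' y' z' j := by
      intro x y z x' y' z' i j hij
      have h1 := (hl x y z).1 i
      have h2 := (hl x' y' z').1 j
      rw [hij] at h1
      exact e.injective (((h2 _).1 ((h1 _).2 rfl)))
    choose vtx hvtx using h.surj
    let lam : Fin n → A := fun x => l x x x 0
    have l0 : ∀ x y z, l x y z 0 = lam x := fun x y z => huniq _ _ _ _ _ _ 0 0 rfl
    have l1 : ∀ x y z, l x y z 1 = lam y := fun x y z => huniq _ _ _ _ _ _ 1 0 rfl
    have l2 : ∀ x y z, l x y z 2 = lam z := fun x y z => huniq _ _ _ _ _ _ 2 0 rfl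
    simp only [l0, l1, l2] at hl
    have hM : ∀ q, min q (M - 1) < M := fun q => by omega
    refine ⟨fun q => lam (vtx (min q (M - 1)) (hM q)), ?_, ?_, ?_, ?_⟩
    · exact (hl _ (vtx 0 (by omega)) (vtx 0 (by omega))).2.2.1 (by rw [hvtx]; omega)
    · intro q hq
      exact (hl (vtx (min (q + 1) (M - 1)) (hM _)) (vtx (min q (M - 1)) (hM _))
        (vtx 0 (by omega))).2.2.2.1 (by rw [hvtx, hvtx]; omega) (by rw [hvtx]; omega)
    · intro q hq hq'
      have := (hl (vtx (min (q + 1) (M - 1)) (hM _)) (vtx (min q (M - 1)) (hM _))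
        (vtx (min (q + 1 - D) (M - 1)) (hM _))).2.2.2.2.1 (by rw [hvtx, hvtx]; omega)
        (by rw [hvtx, hvtx]; omega)
      have hm : mark (pos (vtx (min (q + 1) (M - 1)) (hM _))) = mark (q + 1) := by
        rw [hvtx, min_eq_left (by omega)]
      rwa [hm] at this
    · exact (hl _ (vtx 0 (by omega)) (vtx 0 (by omega))).2.2.2.2.2 (by rw [hvtx]; omega)
  · rintro ⟨μ, H⟩
    refine ⟨fun i => {u | i = e (μ (pos u))}, fun x y z =>
      ⟨![μ (pos x), μ (pos y), μ (pos z)], ?_, ?_, ?_, ?_, ?_, ?_⟩⟩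
    · intro w i
      fin_cases w <;> rfl
    · intro hxy; simp [hxy]
    · intro hx; simpa [hx] using H.init₀
    · intro hx hx'
      have := H.init (pos y) (by omega)
      simpa [hx] using this
    · intro hx hx'
      have := H.step (pos y) (by omega) (by rw [← hx]; exact h.pos_lt x)
      rw [← hx, show pos x - D = pos z by omega] at this
      simpa using this
    · intro hx
      simpa [hx] using H.accept

/-! ### A counter machine that reads the code of a circuit -/

/-- The counters of the reader. A number `a` that it reads off its input, such as the index of a
gate, is represented by the counter value `a + 1`. -/
inductive Track
  /-- the number that is being read -/
  | val
  /-- the weight `k` -/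
  | weight
  /-- the fan-in of the current gate -/
  | len
  /-- the number of arguments of the current gate that have been read -/
  | cnt
  /-- the index of the current gate -/
  | gate
  /-- the number of true input gates among the gates that have been read -/
  | used
  deriving DecidableEq

/-- What the reader expects next. -/
inductive Phase
  | weight | size | out | header | negArg | len | arg
  deriving DecidableEq

/-- The finite control of the reader. `kind` tells `and` gates from `or` gates; `truth` is the
guessed value of the current gate; `acc` says that all arguments read so far have the value
`kind`; `ok` says that no inconsistency has been found; `pending` is an outstanding increment of
the counter `used`. -/
structure Ctrl where
  phase : Phase
  kind : Bool
  acc : Bool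
  ok : Bool
  pending : Bool
  truth : Bool

/-- What one sweep over the counters finds out: the guessed values of the gates in the counters
`val` and `gate`, whether `cnt` equals `len` and `used` equals `weight`, and the smaller of
`val` and `4`. -/
structure Obs where
  valTrue : Bool
  gateTrue : Bool
  lenDone : Bool
  weightDone : Bool
  valClass : Fin 5

instance : Finite Track :=
  Finite.of_surjective ![Track.val, .weight, .len, .cnt, .gate, .used] (by
    rintro ⟨⟩
    exacts [⟨0, rfl⟩, ⟨1, rfl⟩, ⟨2, rfl⟩, ⟨3, rfl⟩, ⟨4, rfl⟩, ⟨5, rfl⟩])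

instance : Finite Phase :=
  Finite.of_surjective ![Phase.weight, .size, .out, .header, .negArg, .len, .arg] (by
    rintro ⟨⟩
    exacts [⟨0, rfl⟩, ⟨1, rfl⟩, ⟨2, rfl⟩, ⟨3, rfl⟩, ⟨4, rfl⟩, ⟨5, rfl⟩, ⟨6, rfl⟩])

instance : Finite Ctrl :=
  Finite.of_injective (fun c : Ctrl => (c.phase, c.kind, c.acc, c.ok, c.pending, c.truth)) (by
    rintro ⟨⟩ ⟨⟩ h; simpa using h)

instance : Finite Obs :=
  Finite.of_injective
    (fun o : Obs => (o.valTrue, o.gateTrue, o.lenDone, o.weightDone, o.valClass)) (by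
    rintro ⟨⟩ ⟨⟩ h; simpa using h)

/-- The ways in which a sweep changes a counter: not at all, by adding one, by setting it to one,
and by setting it to the value of the counter `val`. -/
inductive Move
  | keep | shift | one | copy

/-- The change of each counter when the bit `b` is read. The bit `true` continues the number that
is being read, the bit `false` ends it. -/
def Ctrl.move (c : Ctrl) (b : Bool) : Track → Move
  | .val => if b then .shift else .one
  | .weight => if b then .keep else if c.phase = .weight then .copy else .keep
  | .len => if b then .keep else if c.phase = .len then .copy else .keep
  | .cnt => if b then .keep else if c.phase = .len then .one else
      if c.phase = .arg then .shift else .keep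
  | .gate => if b then .keep else if c.phase = .header then .shift else .keep
  | .used => if c.pending then .shift else .keep

/-- Compare the guessed value of a gate with that determined by its arguments. -/
def Ctrl.check (c : Ctrl) (acc : Bool) : Ctrl :=
  { c with phase := .header, acc := acc, ok := c.ok && (c.truth == (acc == c.kind)),
           pending := false }

/-- The change of the control when the bit `b` is read. -/
def Ctrl.next (c : Ctrl) (b : Bool) (o : Obs) : Ctrl :=
  if b then { c with pending := false } else
  match c.phase with
  | .weight => { c with phase := .size, pending := false }
  | .size => { c with phase := .out, pending := false }
  | .out => { c with phase := .header, pending := false, ok := c.ok && o.valTrue }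
  | .header =>
    if o.valClass = 1 then { c with truth := o.gateTrue, pending := o.gateTrue }
    else if o.valClass = 2 then
      { c with truth := o.gateTrue, pending := false, phase := .negArg }
    else { c with truth := o.gateTrue, pending := false, phase := .len, acc := true,
                  kind := o.valClass = 3 }
  | .negArg => { c with phase := .header, pending := false, ok := c.ok && (c.truth != o.valTrue) }
  | .len => if o.lenDone then c.check c.acc else { c with phase := .arg, pending := false }
  | .arg =>
    if o.lenDone then c.check (c.acc && (o.valTrue == c.kind))
    else { c with acc := c.acc && (o.valTrue == c.kind), pending := false }

/-- A configuration of the reader. -/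
structure Config where
  ctrl : Ctrl
  x : Track → ℕ

/-- The new value of the counter `τ`. -/
def Move.apply (x : Track → ℕ) (τ : Track) : Move → ℕ
  | .keep => x τ
  | .shift => x τ + 1
  | .one => 1
  | .copy => x .val

/-- The symbol of a counter in a cell after the change, chosen from what each of the changes would
put there. -/
def Move.select (keep shift one copy : Bool) : Move → Bool
  | .keep => keep
  | .shift => shift
  | .one => one
  | .copy => copy

/-- The outcome of a sweep with the counters `x` before and `x'` after it, where `T (g + 1)` is
the guessed value of the gate `g`. -/
def Obs.of (T : ℕ → Bool) (x x' : Track → ℕ) : Obs where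
  valTrue := T (x .val)
  gateTrue := T (x' .gate)
  lenDone := x' .cnt = x' .len
  weightDone := x' .used = x' .weight
  valClass := ⟨min (x .val) 4, by omega⟩

/-- The counters after the bit `b` has been read. -/
def Config.nextCounters (h : Config) (b : Bool) (τ : Track) : ℕ := (h.ctrl.move b τ).apply h.x τ

/-- One step of the reader. -/
def Config.read (T : ℕ → Bool) (h : Config) (b : Bool) : Config where
  ctrl := h.ctrl.next b (.of T h.x (h.nextCounters b))
  x := h.nextCounters b

def Ctrl.start : Ctrl where
  phase := .weight
  kind := true
  acc := true
  ok := true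
  pending := false
  truth := true

/-- The counters `val` and `used` represent the number `0` at the start. The others are set before
a comparison of them matters, or count the gates whose headers have been read. -/
def startCounters : Track → ℕ
  | .val => 1
  | .used => 1
  | _ => 0

def Config.start : Config := ⟨.start, startCounters⟩

/-- The reader has found no inconsistency, and the weight is right. -/
def Config.Accepts (h : Config) : Prop := h.ctrl.ok = true ∧ h.x .used = h.x .weight

theorem Config.nextCounters_le {h : Config} {B : ℕ} (hB : ∀ τ, h.x τ ≤ B) (b : Bool) (τ : Track) :
    h.nextCounters b τ ≤ B + 1 := by
  unfold Config.nextCounters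
  have := hB τ
  have := hB .val
  cases h.ctrl.move b τ <;> simp only [Move.apply] <;> omega

theorem foldl_read_le (T : ℕ → Bool) (s : List Bool) (τ : Track) :
    (s.foldl (Config.read T) .start).x τ ≤ s.length + 1 := by
  induction s using List.reverseRecOn generalizing τ with
  | nil => cases τ <;> simp [Config.start, startCounters]
  | append_singleton s b ih =>
    simp only [List.foldl_append, List.foldl_cons, List.foldl_nil, List.length_append,
      List.length_singleton]
    exact Config.nextCounters_le ih b τ

/-! ### The reader as a sweeping automaton -/

/-- A tape cell: for each counter whether its value is the number of this row, the guessed value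
of the gate that belongs to the row, and the smaller of the number of the row and `4`. -/
structure Cell where
  tr : Track → Bool
  truth : Bool
  row : Fin 5

instance : Finite Cell :=
  Finite.of_injective (fun c : Cell => (c.tr, c.truth, c.row)) (by
    rintro ⟨⟩ ⟨⟩ h; simpa using h)

/-- The `j`-th cell of the tape that represents the counters `x`. -/
def Cell.of (T : ℕ → Bool) (x : Track → ℕ) (j : ℕ) : Cell where
  tr τ := x τ = j
  truth := T j
  row := ⟨min j 4, by omega⟩

theorem Cell.tr_of (T : ℕ → Bool) (x : Track → ℕ) (j : ℕ) (τ : Track) :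
    (Cell.of T x j).tr τ = decide (x τ = j) := rfl

theorem Cell.val_row_of (T : ℕ → Bool) (x : Track → ℕ) (j : ℕ) :
    ((Cell.of T x j).row : ℕ) = min j 4 := rfl

theorem Cell.row_of_eq_zero (T : ℕ → Bool) (x : Track → ℕ) (j : ℕ) :
    (Cell.of T x j).row = 0 ↔ j = 0 := by
  rw [Fin.ext_iff, Cell.val_row_of, Fin.val_zero]; omega

theorem Cell.row_of_eq_one (T : ℕ → Bool) (x : Track → ℕ) (j : ℕ) :
    (Cell.of T x j).row = 1 ↔ j = 1 := by
  rw [Fin.ext_iff, Cell.val_row_of, Fin.val_one]; omega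

/-- The label of a position: the contents of the cell before and after the current sweep, the
control and the bit that is read, which do not change during the sweep, and the outcome of the
sweep so far. -/
structure Label where
  old : Cell
  new : Cell
  ctrl : Ctrl
  bit : Bool
  obs : Obs

instance : Finite Label :=
  Finite.of_injective (fun l : Label => (l.old, l.new, l.ctrl, l.bit, l.obs)) (by
    rintro ⟨⟩ ⟨⟩ h; simpa using h)

/-- One step of a sweep, from a cell with the label `prev` to the next one, whose label in the
sweep before was `below`. -/
def Label.step (prev below : Label) (mark : Bool) : Label :=
  let first : Bool := below.new.row = 0
  let ctrl := if first then prev.ctrl.next prev.bit prev.obs else prev.ctrl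
  let bit := if first then mark else prev.bit
  let obs : Obs := if first then ⟨false, false, false, false, 0⟩ else prev.obs
  let new : Cell :=
    { tr := fun τ => (ctrl.move bit τ).select (below.new.tr τ) (!first && prev.old.tr τ)
        (below.new.row = 1) (below.new.tr .val)
      truth := below.new.truth
      row := below.new.row }
  { old := below.new
    new := new
    ctrl := ctrl
    bit := bit
    obs :=
      { valTrue := obs.valTrue || (below.new.tr .val && below.new.truth)
        gateTrue := obs.gateTrue || (new.tr .gate && new.truth)
        lenDone := obs.lenDone || (new.tr .cnt && new.tr .len)
        weightDone := obs.weightDone || (new.tr .used && new.tr .weight)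
        valClass := if below.new.tr .val then below.new.row else obs.valClass } }

/-- The label of the `j`-th cell in the sweep that carries out one step of the reader. -/
def Label.of (T : ℕ → Bool) (h : Config) (b : Bool) (j : ℕ) : Label where
  old := .of T h.x j
  new := .of T (h.nextCounters b) j
  ctrl := h.ctrl
  bit := b
  obs :=
    { valTrue := decide (h.x .val ≤ j) && T (h.x .val)
      gateTrue := decide (h.nextCounters b .gate ≤ j) && T (h.nextCounters b .gate)
      lenDone := decide (h.nextCounters b .cnt ≤ j) &&
        decide (h.nextCounters b .cnt = h.nextCounters b .len)
      weightDone := decide (h.nextCounters b .used ≤ j) &&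
        decide (h.nextCounters b .used = h.nextCounters b .weight)
      valClass := if h.x .val ≤ j then ⟨min (h.x .val) 4, by omega⟩ else 0 }

/-- The first cell of a sweep takes the control from the end of the sweep before, and the bit from
the mark. -/
theorem Label.step_eq_of_zero {T : ℕ → Bool} {h : Config} {b : Bool} {prev below : Label}
    (h1 : prev.ctrl.next prev.bit prev.obs = h.ctrl) (h2 : below.new = .of T h.x 0) :
    prev.step below b = .of T h b 0 := by
  have hnew : ∀ τ, (h.ctrl.move b τ).select ((Cell.of T h.x 0).tr τ) false
      ((Cell.of T h.x 0).row = 1) ((Cell.of T h.x 0).tr .val) =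
        (Cell.of T (h.nextCounters b) 0).tr τ := by
    intro τ
    cases hm : h.ctrl.move b τ <;>
      simp [Cell.tr_of, Cell.row_of_eq_one, Config.nextCounters, hm, Move.apply, Move.select]
  have e : (Cell.of T h.x 0).row = 0 := rfl
  simp only [Label.step, h2, e, decide_true, if_true, h1, Bool.not_true, Bool.false_and,
    Bool.false_or]
  simp only [e] at hnew
  simp only [hnew]
  simp only [Label.of, Cell.of, Nat.le_zero]
  congr 1
  congr 1
  · by_cases h0 : h.x .val = 0 <;> simp [h0]
  · by_cases h0 : h.nextCounters b .gate = 0 <;> simp [h0]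
  · by_cases h0 : h.nextCounters b .cnt = 0 <;> simp [h0, eq_comm]
  · by_cases h0 : h.nextCounters b .used = 0 <;> simp [h0, eq_comm]
  · by_cases h0 : h.x .val = 0 <;> simp [h0]

theorem Label.step_eq_of_succ {T : ℕ → Bool} {h : Config} {b : Bool} {j : ℕ} {below : Label}
    (mark : Bool) (h2 : below.new = .of T h.x (j + 1)) :
    (Label.of T h b j).step below mark = .of T h b (j + 1) := by
  have hnew : ∀ τ, (h.ctrl.move b τ).select ((Cell.of T h.x (j + 1)).tr τ)
      ((Cell.of T h.x j).tr τ) ((Cell.of T h.x (j + 1)).row = 1)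
      ((Cell.of T h.x (j + 1)).tr .val) = (Cell.of T (h.nextCounters b) (j + 1)).tr τ := by
    intro τ
    cases hm : h.ctrl.move b τ <;>
      simp [Cell.tr_of, Cell.row_of_eq_one, Config.nextCounters, hm, Move.apply, Move.select,
        eq_comm (a := j)]
  have e : (Cell.of T h.x (j + 1)).row ≠ 0 := by
    simp [Cell.of, Fin.ext_iff]
  simp only [Label.step, h2, e, decide_false, Bool.not_false, Bool.true_and]
  simp only [Label.of, Bool.false_eq_true, if_false] at hnew ⊢
  simp only [hnew]
  have hle : ∀ (a : ℕ), decide (a ≤ j + 1) = (decide (a ≤ j) || decide (a = j + 1)) := by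
    intro a; rw [← Bool.decide_or]; congr 1; simp; omega
  congr 1
  congr 1
  · by_cases h0 : h.x .val = j + 1 <;> simp [hle, h0, Cell.of]
  · by_cases h0 : h.nextCounters b .gate = j + 1 <;> simp [hle, h0, Cell.of]
  · by_cases h0 : h.nextCounters b .cnt = j + 1 <;> simp [hle, h0, Cell.of, eq_comm (a := j + 1)]
  · by_cases h0 : h.nextCounters b .used = j + 1 <;> simp [hle, h0, Cell.of, eq_comm (a := j + 1)]
  · by_cases h0 : h.x .val = j + 1
    · simp [h0, Cell.of]
    · have : h.x .val ≤ j + 1 ↔ h.x .val ≤ j := by omega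
      simp [h0, this, Cell.of]

/-- A sweep that goes beyond all counter values has the right outcome. -/
theorem Label.obs_of {T : ℕ → Bool} {h : Config} {b : Bool} {j : ℕ} (h1 : ∀ τ, h.x τ ≤ j)
    (h2 : ∀ τ, h.nextCounters b τ ≤ j) :
    (Label.of T h b j).obs = .of T h.x (h.nextCounters b) := by
  simp [Label.of, Obs.of, h1, h2]

/-- The constraints that describe the sweeps of the reader. The first column holds the tape before
the first sweep; there the values of the gates are guessed. -/
noncomputable def sweepConstraints : Constraints Label where
  init₀ l := l.new.row = 0 ∧ (∀ τ, l.new.tr τ = decide (startCounters τ = 0)) ∧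
    l.ctrl = .start ∧ l.bit = true
  init l l' := (l'.new.row : ℕ) = min ((l.new.row : ℕ) + 1) 4 ∧
    (∀ τ, l'.new.tr τ = (decide (l.new.row = 0) && decide (startCounters τ = 1))) ∧
    l'.ctrl = .start ∧ l'.bit = true
  step l l' m l'' := l'' = l.step l' (@decide m (Classical.dec m))
  accept l := (l.ctrl.next l.bit l.obs).ok = true ∧ l.obs.weightDone = true

section Sweeps

variable {D : ℕ} {mark : ℕ → Prop} {μ : ℕ → Label} {s : List Bool}

/-- A labelling that satisfies the constraints, except possibly the last one, simulates the
reader: the column `i` holds the tape after `i` bits have been read, and its last label determines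
the control after that. -/
theorem sweeps_eq {T : ℕ → Bool} (hT : ∀ j < D, (μ j).new.truth = T j)
    (hD : s.length + 3 ≤ D) (hmark : ∀ i (hi : i < s.length), mark ((i + 1) * D) ↔ s[i] = true)
    (h0 : sweepConstraints.init₀ (μ 0))
    (hinit : ∀ q, q + 1 < D → sweepConstraints.init (μ q) (μ (q + 1)))
    (hstep : ∀ q, D ≤ q + 1 → q + 1 < (s.length + 1) * D →
      sweepConstraints.step (μ q) (μ (q + 1 - D)) (mark (q + 1)) (μ (q + 1)))
    (i : ℕ) (hi : i ≤ s.length) :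
    (∀ j < D, (μ (i * D + j)).new = .of T ((s.take i).foldl (Config.read T) .start).x j) ∧
    (∀ l, l = μ (i * D + (D - 1)) → l.ctrl.next l.bit l.obs =
        ((s.take i).foldl (Config.read T) .start).ctrl ∧
      (0 < i → (l.obs.weightDone = true ↔ ((s.take i).foldl (Config.read T) .start).x .used =
        ((s.take i).foldl (Config.read T) .start).x .weight))) := by
  induction i with
  | zero =>
    simp only [Nat.zero_mul, Nat.zero_add, List.take_zero, List.foldl_nil]
    have key : ∀ j < D, (μ j).new = .of T startCounters j ∧ (μ j).ctrl = .start ∧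
        (μ j).bit = true := by
      intro j hj
      induction j with
      | zero =>
        obtain ⟨h1, h2, h3, h4⟩ := h0
        refine ⟨?_, h3, h4⟩
        have := hT 0 hj
        generalize (μ 0).new = c at *
        obtain ⟨tr, tv, row⟩ := c
        simp only at *
        simp only [Cell.of, h1, this, Cell.mk.injEq, Nat.zero_min, true_and]
        exact ⟨funext h2, rfl⟩
      | succ j ih =>
        obtain ⟨h1, h2, h3, h4⟩ := hinit j hj
        refine ⟨?_, h3, h4⟩
        have h5 := hT (j + 1) hj
        have h6 := (ih (by omega)).1
        rw [h6] at h1 h2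
        generalize (μ (j + 1)).new = c at *
        obtain ⟨tr, tv, row⟩ := c
        simp only at *
        simp only [Cell.of, h5, Cell.mk.injEq, true_and]
        refine ⟨funext fun τ => (h2 τ).trans ?_, Fin.ext (h1.trans ?_)⟩
        · simp only [Cell.row_of_eq_zero, ← Bool.decide_and]
          rw [decide_eq_decide]
          cases τ <;> simp [startCounters]
        · simp only [Cell.val_row_of]; omega
    refine ⟨fun j hj => (key j hj).1, ?_⟩
    rintro l rfl
    refine ⟨?_, by simp⟩
    obtain ⟨-, h1, h2⟩ := key (D - 1) (by omega)
    rw [h1, h2]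
    rfl
  | succ i ih =>
    obtain ⟨ih1, ih2⟩ := ih (by omega)
    have hlen : ∀ τ, ((s.take i).foldl (Config.read T) .start).x τ ≤ i + 1 := fun τ =>
      (foldl_read_le T _ τ).trans (by simp)
    have htake : (s.take (i + 1)).foldl (Config.read T) .start =
        ((s.take i).foldl (Config.read T) .start).read T s[i] := by
      rw [List.take_add_one, List.foldl_append, List.getElem?_eq_getElem (by omega)]
      rfl
    rw [htake]
    generalize (s.take i).foldl (Config.read T) .start = h at *
    have hmul : (i + 1) * D + D ≤ (s.length + 1) * D := by
      rw [← Nat.succ_mul]; exact Nat.mul_le_mul_right D (by omega)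
    have e : (i + 1) * D = i * D + D := Nat.succ_mul i D
    have key : ∀ j < D, μ ((i + 1) * D + j) = .of T h s[i] j := by
      intro j hj
      induction j with
      | zero =>
        have h1 := hstep (i * D + (D - 1)) (by omega) (by omega)
        rw [show i * D + (D - 1) + 1 = (i + 1) * D + 0 by omega,
          show (i + 1) * D + 0 - D = i * D + 0 by omega] at h1
        refine (show _ = _ from h1).trans ?_
        have h2 : @decide (mark ((i + 1) * D + 0)) (Classical.dec _) = s[i] := by
          have := hmark i (by omega)
          cases h : s[i] <;> simp_all
        rw [h2]
        exact Label.step_eq_of_zero (ih2 _ rfl).1 (ih1 0 hj)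
      | succ j ihj =>
        have h1 := hstep ((i + 1) * D + j) (by omega) (by omega)
        rw [show (i + 1) * D + j + 1 - D = i * D + (j + 1) by omega, ihj (by omega)] at h1
        refine (show _ = _ from h1).trans ?_
        exact Label.step_eq_of_succ _ (ih1 (j + 1) hj)
    have hobs : (Label.of T h s[i] (D - 1)).obs = .of T h.x (h.nextCounters s[i]) :=
      Label.obs_of (fun τ => (hlen τ).trans (by omega))
        (fun τ => (Config.nextCounters_le hlen s[i] τ).trans (by omega))
    refine ⟨fun j hj => by rw [key j hj]; rfl, ?_⟩
    rintro l rfl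
    rw [key _ (by omega), hobs]
    exact ⟨rfl, fun _ => by simp [Obs.of, Config.read]⟩

/-- A labelling built from the first column on. -/
noncomputable def runSweeps (D : ℕ) (mark : ℕ → Prop) (init : ℕ → Label) : ℕ → Label
  | 0 => init 0
  | q + 1 =>
    if 0 < D ∧ D ≤ q + 1 then
      (runSweeps D mark init q).step (runSweeps D mark init (q + 1 - D))
        (@decide (mark (q + 1)) (Classical.dec _))
    else init (q + 1)
termination_by q => q

/-- Valid labellings correspond to accepting runs of the reader. -/
theorem exists_valid_sweepConstraints_iff (hD : s.length + 3 ≤ D)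
    (hmark : ∀ i (hi : i < s.length), mark ((i + 1) * D) ↔ s[i] = true) (hs : s ≠ []) :
    (∃ μ, sweepConstraints.Valid D ((s.length + 1) * D) mark μ) ↔
      ∃ T, (s.foldl (Config.read T) .start).Accepts := by
  have hlast : (s.length + 1) * D - 1 = s.length * D + (D - 1) := by
    rw [Nat.succ_mul]; omega
  have hpos : 0 < s.length := List.length_pos_iff.2 hs
  constructor
  · rintro ⟨μ, h⟩
    refine ⟨fun j => (μ j).new.truth, ?_⟩
    obtain ⟨-, h1⟩ := sweeps_eq (fun _ _ => rfl) hD hmark h.init₀ h.init h.step s.length le_rfl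
    obtain ⟨h2, h3⟩ := h1 _ rfl
    rw [List.take_length] at h2 h3
    obtain ⟨h4, h5⟩ := h.accept
    rw [hlast] at h4 h5
    exact ⟨h2 ▸ h4, (h3 hpos).1 h5⟩
  · rintro ⟨T, hT⟩
    let init : ℕ → Label := fun j =>
      ⟨.of T startCounters j, .of T startCounters j, .start, true, ⟨false, false, false, false, 0⟩⟩
    have hμ : ∀ j < D, runSweeps D mark init j = init j := by
      intro j hj
      cases j with
      | zero => rw [runSweeps]
      | succ j => rw [runSweeps, if_neg (by omega)]
    have h0 : sweepConstraints.init₀ (runSweeps D mark init 0) := by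
      rw [hμ 0 (by omega)]
      exact ⟨rfl, fun τ => rfl, rfl, rfl⟩
    have h1 : ∀ q, q + 1 < D →
        sweepConstraints.init (runSweeps D mark init q) (runSweeps D mark init (q + 1)) := by
      intro q hq
      rw [hμ q (by omega), hμ (q + 1) hq]
      refine ⟨?_, fun τ => ?_, rfl, rfl⟩
      · simp only [init, Cell.val_row_of]; omega
      · simp only [init, Cell.tr_of, Cell.row_of_eq_zero, ← Bool.decide_and]
        rw [decide_eq_decide]
        cases τ <;> simp [startCounters]
    have h2 : ∀ q, D ≤ q + 1 → q + 1 < (s.length + 1) * D → sweepConstraints.step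
        (runSweeps D mark init q) (runSweeps D mark init (q + 1 - D)) (mark (q + 1))
        (runSweeps D mark init (q + 1)) := by
      intro q hq _
      change runSweeps D mark init (q + 1) = _
      rw [runSweeps, if_pos (by omega)]
    refine ⟨runSweeps D mark init, h0, h1, h2, ?_⟩
    obtain ⟨-, h3⟩ := sweeps_eq (T := T) (fun j hj => by rw [hμ j hj]; rfl) hD hmark h0 h1 h2
      s.length le_rfl
    obtain ⟨h4, h5⟩ := h3 _ rfl
    rw [List.take_length] at h4 h5
    rw [hlast]
    exact ⟨h4 ▸ hT.1, (h5 hpos).2 hT.2⟩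

end Sweeps

/-! ### The reader checks weighted satisfiability -/

/-- The reader reads a whole number `a`. -/
def Config.token (T : ℕ → Bool) (h : Config) (a : ℕ) : Config :=
  (List.replicate a true ++ [false]).foldl (Config.read T) h

theorem foldl_read_unary (T : ℕ → Bool) (h : Config) (l : List ℕ) :
    (unary l).foldl (Config.read T) h = l.foldl (Config.token T) h := by
  induction l generalizing h with
  | nil => rfl
  | cons a l ih =>
    rw [show unary (a :: l) = (List.replicate a true ++ [false]) ++ unary l from rfl,
      List.foldl_append, ih]
    rfl

/-- The counters after the number `a` has been read. -/
def Config.tokenCounters (h : Config) (a : ℕ) (τ : Track) : ℕ :=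
  if τ = .used then h.x .used + h.ctrl.pending.toNat
  else (h.ctrl.move false τ).apply (fun τ => if τ = .val then a + 1 else h.x τ) τ

theorem foldl_read_replicate (T : ℕ → Bool) (h : Config) (a : ℕ) :
    (List.replicate (a + 1) true).foldl (Config.read T) h =
      ⟨{ h.ctrl with pending := false }, fun τ => if τ = .val then h.x .val + (a + 1) else
        if τ = .used then h.x .used + h.ctrl.pending.toNat else h.x τ⟩ := by
  have h1 : ∀ h : Config, h.read T true = ⟨{ h.ctrl with pending := false }, fun τ =>
      if τ = .val then h.x .val + 1 else
      if τ = .used then h.x .used + h.ctrl.pending.toNat else h.x τ⟩ := by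
    intro h
    simp only [Config.read, Ctrl.next, if_true, Config.mk.injEq, true_and]
    funext τ
    cases τ <;> simp [Config.nextCounters, Ctrl.move, Move.apply]
    cases h.ctrl.pending <;> simp
  induction a generalizing h with
  | zero => exact h1 h
  | succ a ih =>
    rw [List.replicate_succ, List.foldl_cons, ih, h1]
    simp only [Config.mk.injEq, true_and]
    funext τ
    cases τ <;> simp
    omega

/-- What the reader does to its counters and its control at the end of a number depends only on the
number, the control and the other counters. -/
theorem Config.token_eq (T : ℕ → Bool) {h : Config} (hv : h.x .val = 1) (a : ℕ) :
    h.token T a = ⟨h.ctrl.next false (.of T (fun _ => a + 1) (h.tokenCounters a)),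
      h.tokenCounters a⟩ := by
  have hnext : ∀ (c : Ctrl) (o : Obs), Ctrl.next { c with pending := false } false o =
      c.next false o := by
    rintro ⟨ph, kind, acc, ok, pending, truth⟩ o
    cases ph <;> simp [Ctrl.next, Ctrl.check]
  have hx : (h.token T a).x = h.tokenCounters a ∧ (h.token T a).ctrl =
      h.ctrl.next false (.of T (fun _ => a + 1) (h.token T a).x) := by
    simp only [Config.token, List.foldl_append, List.foldl_cons, List.foldl_nil]
    cases a with
    | zero =>
      simp only [List.replicate_zero, List.foldl_nil, Config.read]
      constructor
      · funext τ
        cases τ <;> simp only [Config.nextCounters, Config.tokenCounters, Ctrl.move] <;>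
          cases h.ctrl.pending <;> cases h.ctrl.phase <;> simp [Move.apply, hv]
      · simp only [Obs.of, hv]
    | succ a =>
      rw [foldl_read_replicate]
      simp only [Config.read]
      constructor
      · funext τ
        cases τ <;> simp only [Config.nextCounters, Config.tokenCounters, Ctrl.move, hv] <;>
          cases h.ctrl.phase <;> simp [Move.apply] <;> omega
      · rw [hnext]
        simp only [Obs.of, hv, if_true]
        congr 2 <;> simp [Nat.add_comm 1]
  obtain ⟨h1, h2⟩ := hx
  rw [h1] at h2
  generalize h.token T a = c at *
  obtain ⟨c, x⟩ := c
  simp only at h1 h2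
  rw [h1, h2]

theorem Config.token_val {T : ℕ → Bool} {h : Config} (hv : h.x .val = 1) (a : ℕ) :
    (h.token T a).x .val = 1 := by
  rw [Config.token_eq T hv]
  simp [Config.tokenCounters, Ctrl.move, Move.apply]

/-- The reader is about to read the gate `g`. So far it has found `u` true input gates. -/
structure Config.AtHeader (h : Config) (g u k : ℕ) (ok : Bool) : Prop where
  phase : h.ctrl.phase = .header
  val : h.x .val = 1
  gate : h.x .gate = g
  used : h.x .used + h.ctrl.pending.toNat = u + 1
  weight : h.x .weight = k + 1
  ok : h.ctrl.ok = ok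

/-- The reader is about to read the first of `c > 0` further arguments of an `and` gate or an `or`
gate. -/
structure Config.AtArg (h : Config) (c g u k : ℕ) (ok kind acc truth : Bool) : Prop where
  phase : h.ctrl.phase = .arg
  val : h.x .val = 1
  len : h.x .len = h.x .cnt + c
  gate : h.x .gate = g
  used : h.x .used + h.ctrl.pending.toNat = u + 1
  weight : h.x .weight = k + 1
  ok : h.ctrl.ok = ok
  kind : h.ctrl.kind = kind
  acc : h.ctrl.acc = acc
  truth : h.ctrl.truth = truth

variable {T : ℕ → Bool} {h : Config} {g u k : ℕ} {ok kind acc truth : Bool}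

/-- The reader reads the remaining arguments, and then checks the guessed value of the gate: an
`and` gate has the value `true`, and an `or` gate the value `false`, if and only if all arguments
have this value. -/
theorem Config.AtArg.foldl (as : List ℕ) (has : as ≠ [])
    (hh : h.AtArg as.length g u k ok kind acc truth) :
    (as.foldl (Config.token T) h).AtHeader g u k
      (ok && (truth == ((acc && as.all fun a => T (a + 1) == kind) == kind))) := by
  induction as generalizing h acc with
  | nil => exact absurd rfl has
  | cons a as ih =>
    obtain ⟨h1, h2, h3, h4, h5, h6, h7, h8, h9, h10⟩ := hh
    rw [List.foldl_cons, Config.token_eq T h2]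
    simp only [List.length_cons] at h3
    rcases as with _ | ⟨a', as⟩
    · constructor <;>
        simp [Config.tokenCounters, Ctrl.move, Ctrl.next, Ctrl.check, Obs.of, Move.apply, h1, h3,
          h4, h6, h7, h8, h9, h10, h5]
    · have : h.x .cnt + 1 ≠ h.x .len := by simp only [List.length_cons] at h3; omega
      have key := ih (h := ⟨h.ctrl.next false (.of T (fun _ => a + 1) (h.tokenCounters a)),
        h.tokenCounters a⟩) (acc := acc && (T (a + 1) == kind)) (by simp) ?_
      · rw [List.all_cons, ← Bool.and_assoc]
        exact key
      · constructor <;>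
          simp [Config.tokenCounters, Ctrl.move, Ctrl.next, Obs.of, Move.apply, h1, this, h4, h6,
            h7, h8, h9, h10, h5]
        simp only [List.length_cons] at h3
        omega

def Gate.isInput {i : ℕ} : Gate i → Bool
  | .input => true
  | _ => false

/-- The gate `i` has the value that its arguments determine, if `T (g + 1)` is the value of each
gate `g`. -/
def Gate.consistent (T : ℕ → Bool) {i : ℕ} : Gate i → Bool
  | .input => true
  | .neg a => T (i + 1) != T (a + 1)
  | .and as => T (i + 1) == as.all fun a => T (a + 1)
  | .or as => T (i + 1) == as.any fun a => T (a + 1)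

/-- The reader reads the code of an `and` gate or an `or` gate. -/
theorem Config.AtHeader.foldl_args (hh : h.AtHeader g u k ok) (kind : Bool) (as : List ℕ) :
    (((if kind then 2 else 3) :: as.length :: as).foldl (Config.token T) h).AtHeader (g + 1) u k
      (ok && (T (g + 1) == ((as.all fun a => T (a + 1) == kind) == kind))) := by
  obtain ⟨h1, h2, h3, h4, h5, h6⟩ := hh
  rw [List.foldl_cons, Config.token_eq T h2]
  rw [List.foldl_cons, Config.token_eq T (by simp [Config.tokenCounters, Ctrl.move, Move.apply])]
  rcases as with _ | ⟨a, as⟩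
  · constructor <;> cases kind <;>
      simp [Config.tokenCounters, Ctrl.move, Ctrl.next, Ctrl.check, Obs.of, Move.apply, h1, h3, h5,
        h6, h4, Fin.ext_iff]
  · refine Config.AtArg.foldl (acc := true) (a :: as) (by simp) ?_
    constructor <;> cases kind <;>
      simp [Config.tokenCounters, Ctrl.move, Ctrl.next, Obs.of, Move.apply, h1, h3, h5, h6, h4,
        Fin.ext_iff]
    all_goals omega

/-- The reader reads the code of a gate. -/
theorem Config.AtHeader.foldl_gate {i : ℕ} (hh : h.AtHeader i u k ok) (p : Gate i) :
    (p.code.foldl (Config.token T) h).AtHeader (i + 1)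
      (u + (p.isInput && T (i + 1)).toNat) k (ok && p.consistent T) := by
  cases p with
  | input =>
    obtain ⟨h1, h2, h3, h4, h5, h6⟩ := hh
    rw [Gate.code, List.foldl_cons, List.foldl_nil, Config.token_eq T h2]
    constructor <;>
      simp [Config.tokenCounters, Ctrl.move, Ctrl.next, Obs.of, Move.apply, h1, h3, h5, h6, h4,
        Gate.isInput, Gate.consistent]
    omega
  | neg a =>
    obtain ⟨h1, h2, h3, h4, h5, h6⟩ := hh
    rw [Gate.code, List.foldl_cons, List.foldl_cons, List.foldl_nil, Config.token_eq T h2]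
    rw [Config.token_eq T (by simp [Config.tokenCounters, Ctrl.move, Move.apply])]
    constructor <;>
      simp [Config.tokenCounters, Ctrl.move, Ctrl.next, Obs.of, Move.apply, h1, h3, h5, h6, h4,
        Fin.ext_iff, Gate.isInput, Gate.consistent]
  | and as =>
    have := hh.foldl_args (T := T) true (as.map Fin.val)
    simp only [if_true, List.length_map, List.all_map] at this
    simpa [Gate.code, Gate.isInput, Gate.consistent, Function.comp_def] using this
  | or as =>
    have := hh.foldl_args (T := T) false (as.map Fin.val)
    simp only [Bool.false_eq_true, if_false, List.length_map, List.all_map] at this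
    have e : ((as.all fun a => T (a + 1) == false) == false) = as.any fun a => T (a + 1) := by
      rw [List.any_eq_not_all_not]
      simp
    simp only [Function.comp_def, e] at this
    simpa [Gate.code, Gate.isInput, Gate.consistent] using this

theorem Circuit.foldl_gates (C : Circuit) (hh : h.AtHeader 0 0 k ok) (j : ℕ) (hj : j ≤ C.size) :
    ((((List.finRange C.size).take j).flatMap fun i => (C.gate i).code).foldl
      (Config.token T) h).AtHeader j
      (((List.finRange C.size).take j).countP fun i => (C.gate i).isInput && T (i + 1)) k
      (ok && ((List.finRange C.size).take j).all fun i => (C.gate i).consistent T) := by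
  induction j with
  | zero => simpa using hh
  | succ j ih =>
    have e : (List.finRange C.size).take (j + 1) =
        (List.finRange C.size).take j ++ [⟨j, hj⟩] := by
      rw [List.take_add_one, List.getElem?_eq_getElem (by simpa using hj)]
      simp
    rw [e, List.flatMap_append, List.foldl_append, List.countP_append, List.all_append,
      ← Bool.and_assoc]
    have := (ih (by omega)).foldl_gate (C.gate ⟨j, hj⟩) (T := T)
    simpa [List.countP_singleton, Bool.toNat, Bool.cond_eq_ite] using this

/-- Acceptance for a given guess. The extra bit at the end of the input ends one more number, so
that an increment of `used` that is still outstanding after the last gate is carried out. -/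
theorem Circuit.accepts_iff (C : Circuit) (k : ℕ) (T : ℕ → Bool) :
    ((unary (k :: C.code) ++ [false]).foldl (Config.read T) .start).Accepts ↔
      T (C.out + 1) = true ∧ (∀ i, (C.gate i).consistent T = true) ∧
      (Finset.univ.filter fun i => (C.gate i).isInput && T (i + 1)).card = k := by
  have e : unary (k :: C.code) ++ [false] = unary ([k, C.size, C.out] ++
      (((List.finRange C.size).take C.size).flatMap fun i => (C.gate i).code) ++ [0]) := by
    rw [List.take_of_length_le (by simp)]
    simp [unary, Circuit.code]
  rw [e, foldl_read_unary, List.foldl_append, List.foldl_append]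
  have h0 : ([k, C.size, (C.out : ℕ)].foldl (Config.token T) .start).AtHeader 0 0 k
      (T (C.out + 1)) := by
    simp only [List.foldl_cons, List.foldl_nil]
    have h1 : Config.start.x .val = 1 := rfl
    rw [Config.token_eq T (Config.token_val (Config.token_val h1 _) _),
      Config.token_eq T (Config.token_val h1 _), Config.token_eq T h1]
    constructor <;> simp [Config.tokenCounters, Ctrl.move, Ctrl.next, Obs.of, Move.apply,
      Config.start, Ctrl.start, startCounters]
  have h1 := C.foldl_gates (T := T) h0 C.size le_rfl
  rw [List.take_of_length_le (l := List.finRange C.size) (i := C.size) (by simp)] at h1 ⊢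
  generalize List.foldl (Config.token T) (List.foldl (Config.token T) .start _) _ = c at h1 ⊢
  obtain ⟨h1, h2, h3, h4, h5, h6⟩ := h1
  rw [List.foldl_cons, List.foldl_nil, Config.token_eq T h2]
  have hcard : (Finset.univ.filter fun i => ((C.gate i).isInput && T (i + 1)) = true).card =
      (List.finRange C.size).countP fun i => (C.gate i).isInput && T (i + 1) := by
    rw [List.countP_eq_length_filter, Fin.univ_def]
    simp [Finset.filter, Finset.card]
  rw [hcard]
  simp only [Config.Accepts, Config.tokenCounters, Ctrl.move, Ctrl.next, h1]
  simp [Move.apply, h4, h5, h6, Obs.of, and_assoc]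

/-- Some guess of the values of the gates leads to acceptance if and only if the circuit has a
satisfying assignment of weight `k`. -/
theorem Circuit.exists_accepts_iff (C : Circuit) (k : ℕ) :
    (∃ T, ((unary (k :: C.code) ++ [false]).foldl (Config.read T) .start).Accepts) ↔
      C.HasSatWeight k := by
  classical
  simp only [Circuit.accepts_iff]
  constructor
  · rintro ⟨T, h1, h2, h3⟩
    have key : ∀ i, C.value (Finset.univ.filter fun i => (C.gate i).isInput && T (i + 1)) i ↔
        T (i + 1) = true := by
      rintro ⟨i, hi⟩
      induction i using Nat.strong_induction_on with
      | _ i ih =>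
        have hc := h2 ⟨i, hi⟩
        rw [Circuit.value]
        split <;> rename_i hg
        · simp [hg, Gate.isInput]
        · rw [ih _ (Fin.is_lt _)]
          simp only [hg, Gate.consistent] at hc
          revert hc
          cases T (i + 1) <;> simp
        · rename_i as
          simp only [hg, Gate.consistent, beq_iff_eq] at hc
          simp only [hc, List.all_eq_true]
          exact forall₂_congr fun a _ => ih _ a.2 _
        · rename_i as
          simp only [hg, Gate.consistent, beq_iff_eq] at hc
          simp only [hc, List.any_eq_true]
          exact exists_congr fun a => and_congr_right fun _ => ih _ a.2 _
    refine ⟨_, fun i hi => ?_, h3, (key _).2 h1⟩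
    simp only [Finset.mem_filter, Finset.mem_univ, true_and, Bool.and_eq_true] at hi
    revert hi
    cases C.gate i <;> simp [Gate.isInput]
  · rintro ⟨S, h1, h2, h3⟩
    let T : ℕ → Bool := fun j => decide (∃ h : j - 1 < C.size, C.value S ⟨j - 1, h⟩)
    have hT : ∀ i : Fin C.size, T (i + 1) = decide (C.value S i) := by
      intro i
      simp only [T, Nat.add_sub_cancel]
      congr 1
      simp
    refine ⟨T, by simpa [hT] using h3, fun i => ?_, ?_⟩
    · have hT' : ∀ a : Fin i, T (a + 1) = decide (C.value S ⟨a, a.2.trans i.2⟩) :=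
        fun a => hT ⟨a, a.2.trans i.2⟩
      have hv := hT i
      rw [Circuit.value] at hv
      revert hv
      cases C.gate i with
      | input => simp [Gate.consistent]
      | neg a => simp only [Gate.consistent, hT']; intro hv; rw [hv]; simp
      | and as =>
        simp only [Gate.consistent, hT']; intro hv; rw [hv, beq_iff_eq, Bool.eq_iff_iff]; simp
      | or as =>
        simp only [Gate.consistent, hT']; intro hv; rw [hv, beq_iff_eq, Bool.eq_iff_iff]; simp
    · rw [← h2]
      congr 1
      ext i
      simp only [Finset.mem_filter, Finset.mem_univ, true_and, hT, Bool.and_eq_true,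
        decide_eq_true_eq]
      rw [Circuit.value]
      constructor
      · rintro ⟨hi, hv⟩
        revert hi hv
        cases C.gate i <;> simp [Gate.isInput]
      · intro hi
        simp [h1 i hi, Gate.isInput, hi]

/-! ### Structured programs on stacks -/

section Programs

variable {K : Type} {Γ : K → Type} {R : Type}

/-- Structured programs that work on the stacks `k : K`, the stack `k` having the alphabet `Γ k`.
A symbol that is popped is translated by `dec` into an element of a fixed type `R`, on which the
continuation may depend. The program `loop k dec q` pops the stack `k` until it is empty, and runs
`q` on every popped symbol. -/
inductive Prog (Γ : K → Type) (R : Type) : Type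
  | skip : Prog Γ R
  | push (k : K) (a : Γ k) : Prog Γ R
  | seq (p q : Prog Γ R) : Prog Γ R
  | ifpop (k : K) (dec : Γ k → R) (p : Prog Γ R) (q : R → Prog Γ R) : Prog Γ R
  | loop (k : K) (dec : Γ k → R) (q : R → Prog Γ R) : Prog Γ R

namespace Prog

/-- The labels of the machine code of a program. -/
def Lab : Prog Γ R → Type
  | skip => Unit
  | push _ _ => Unit
  | seq p q => p.Lab ⊕ q.Lab
  | ifpop _ _ p q => Option (p.Lab ⊕ Σ r, (q r).Lab)
  | loop _ _ q => Option (Σ r, (q r).Lab)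

theorem finite_lab [Finite R] (p : Prog Γ R) : Finite p.Lab := by
  induction p with
  | skip => exact inferInstanceAs (Finite Unit)
  | push => exact inferInstanceAs (Finite Unit)
  | seq p q hp hq => exact inferInstanceAs (Finite (p.Lab ⊕ q.Lab))
  | ifpop k dec p q hp hq => exact inferInstanceAs (Finite (Option (p.Lab ⊕ Σ r, (q r).Lab)))
  | loop k dec q hq => exact inferInstanceAs (Finite (Option (Σ r, (q r).Lab)))

/-- The label at which the machine code of a program starts. -/
def entry : (p : Prog Γ R) → p.Lab
  | skip => ()
  | push _ _ => ()
  | seq p _ => Sum.inl p.entry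
  | ifpop _ _ _ _ => none
  | loop _ _ _ => none

/-- The machine code of a program, which is to be continued at the label `exit`. The labels of
the program are embedded by `emb` into those of the whole machine. The internal state has a
component of an arbitrary type `σ`, which is left alone, and a register for the symbol popped
last. -/
def code {Λ σ : Type} : (p : Prog Γ R) → (exit : Λ) → (emb : p.Lab → Λ) → p.Lab →
    TM2.Stmt Γ Λ (σ × Option R)
  | skip, exit, _, _ => .goto fun _ => exit
  | push k a, exit, _, _ => .push k (fun _ => a) (.goto fun _ => exit)
  | seq p q, _, emb, .inl l =>
    p.code (emb (.inr q.entry)) (fun l => emb (.inl l)) l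
  | seq _ q, exit, emb, .inr l => q.code exit (fun l => emb (.inr l)) l
  | ifpop k dec p q, _, emb, none =>
    .pop k (fun s o => (s.1, o.map dec)) (.goto fun s =>
      match s.2 with
      | none => emb (some (.inl p.entry))
      | some r => emb (some (.inr ⟨r, (q r).entry⟩)))
  | ifpop _ _ p _, exit, emb, some (.inl l) =>
    p.code exit (fun l => emb (some (.inl l))) l
  | ifpop _ _ _ q, exit, emb, some (.inr ⟨r, l⟩) =>
    (q r).code exit (fun l => emb (some (.inr ⟨r, l⟩))) l
  | loop k dec q, exit, emb, none =>
    .pop k (fun s o => (s.1, o.map dec)) (.goto fun s =>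
      match s.2 with
      | none => exit
      | some r => emb (some ⟨r, (q r).entry⟩))
  | loop _ _ q, _, emb, some ⟨r, l⟩ =>
    (q r).code (emb none) (fun l => emb (some ⟨r, l⟩)) l

variable [DecidableEq K]

/-- Big-step semantics: `Runs p S S' t` says that the program `p`, started with the stacks `S`,
ends with the stacks `S'` after exactly `t` steps of its machine code. -/
inductive Runs : Prog Γ R → (∀ k, List (Γ k)) → (∀ k, List (Γ k)) → ℕ → Prop
  | skip {S} : Runs .skip S S 1
  | push {S k a} : Runs (.push k a) S (update S k (a :: S k)) 1
  | seq {p q S S' S'' t t'} :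
    Runs p S S' t → Runs q S' S'' t' → Runs (.seq p q) S S'' (t + t')
  | ifpop_nil {k dec p q S S' t} :
    S k = [] → Runs p S S' t → Runs (.ifpop k dec p q) S S' (1 + t)
  | ifpop_cons {k dec p q S S' a l t} :
    S k = a :: l → Runs (q (dec a)) (update S k l) S' t → Runs (.ifpop k dec p q) S S' (1 + t)
  | loop_nil {k dec q S} : S k = [] → Runs (.loop k dec q) S S 1
  | loop_cons {k dec q S S' S'' a l t t'} :
    S k = a :: l → Runs (q (dec a)) (update S k l) S' t → Runs (.loop k dec q) S' S'' t' →
    Runs (.loop k dec q) S S'' (1 + t + t')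

end Prog

/-- The machine `M` gets from the configuration `c` to `c'` in exactly `t` steps. -/
def StepsTo {Λ σ : Type} [DecidableEq K] (M : Λ → TM2.Stmt Γ Λ σ) (t : ℕ)
    (c c' : TM2.Cfg Γ Λ σ) : Prop :=
  (flip bind (TM2.step M))^[t] (some c) = some c'

section

variable {Λ σ : Type} [DecidableEq K] {M : Λ → TM2.Stmt Γ Λ σ}

theorem StepsTo.trans {t t' : ℕ} {c c' c'' : TM2.Cfg Γ Λ σ} (h : StepsTo M t c c')
    (h' : StepsTo M t' c' c'') : StepsTo M (t + t') c c'' := by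
  unfold StepsTo at *
  rw [Nat.add_comm, iterate_add_apply, h, h']

theorem StepsTo.one {c c' : TM2.Cfg Γ Λ σ} (h : TM2.step M c = some c') : StepsTo M 1 c c' := by
  simpa [StepsTo, flip] using h

end

/-- The machine code of a program carries out its big-step semantics. -/
theorem Prog.Runs.stepsTo [DecidableEq K] {p : Prog Γ R} {S S' : ∀ k, List (Γ k)} {t : ℕ}
    (h : p.Runs S S' t) {Λ σ : Type} (M : Λ → TM2.Stmt Γ Λ (σ × Option R)) (exit : Λ)
    (emb : p.Lab → Λ) (hM : ∀ l, M (emb l) = p.code exit emb l) (s : σ) (r : Option R) :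
    ∃ r', StepsTo M t ⟨some (emb p.entry), (s, r), S⟩ ⟨some exit, (s, r'), S'⟩ := by
  induction h generalizing exit r with
  | skip => exact ⟨r, .one (congrArg (fun q => some (TM2.stepAux q _ _)) (hM _))⟩
  | push => exact ⟨r, .one (congrArg (fun q => some (TM2.stepAux q _ _)) (hM _))⟩
  | @seq p q S S' S'' t t' _ _ ih ih' =>
    obtain ⟨r1, h1⟩ := ih (emb (.inr q.entry)) (fun l => emb (.inl l)) (fun l => hM (.inl l)) r
    obtain ⟨r2, h2⟩ := ih' exit (fun l => emb (.inr l)) (fun l => hM (.inr l)) r1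
    exact ⟨r2, h1.trans h2⟩
  | @ifpop_nil k dec p q S S' t hS _ ih =>
    obtain ⟨r1, h1⟩ := ih exit (fun l => emb (some (.inl l))) (fun l => hM (some (.inl l))) none
    refine ⟨r1, StepsTo.trans (.one ?_) h1⟩
    have : update S k [] = S := by rw [← hS]; simp
    refine (congrArg (fun q => some (TM2.stepAux q _ _)) (hM none)).trans ?_
    simp only [code, TM2.stepAux, hS, List.head?_nil, List.tail_nil, Option.map_none, this]
  | @ifpop_cons k dec p q S S' a l t hS _ ih =>
    obtain ⟨r1, h1⟩ := ih exit (fun l => emb (some (.inr ⟨_, l⟩)))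
      (fun l => hM (some (.inr ⟨_, l⟩))) (some (dec a))
    refine ⟨r1, StepsTo.trans (.one ?_) h1⟩
    refine (congrArg (fun q => some (TM2.stepAux q _ _)) (hM none)).trans ?_
    simp only [code, TM2.stepAux, hS, List.head?_cons, List.tail_cons, Option.map_some]
  | @loop_nil k dec q S hS =>
    refine ⟨none, .one ?_⟩
    have : update S k [] = S := by rw [← hS]; simp
    refine (congrArg (fun q => some (TM2.stepAux q _ _)) (hM none)).trans ?_
    simp only [code, TM2.stepAux, hS, List.head?_nil, List.tail_nil, Option.map_none, this]
  | @loop_cons k dec q S S' S'' a l t t' hS _ _ ih ih' =>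
    obtain ⟨r1, h1⟩ := ih (emb none) (fun l => emb (some ⟨_, l⟩)) (fun l => hM (some ⟨_, l⟩))
      (some (dec a))
    obtain ⟨r2, h2⟩ := ih' exit emb hM r1
    refine ⟨r2, StepsTo.trans (StepsTo.trans (.one ?_) h1) h2⟩
    refine (congrArg (fun q => some (TM2.stepAux q _ _)) (hM none)).trans ?_
    simp only [code, TM2.stepAux, hS, List.head?_cons, List.tail_cons, Option.map_some]

end Programs

/-! ### Running a program on the output of a machine -/

section Composition

variable {K₁ K₂ : Type} {Γ₁ : K₁ → Type} {Γ₂ : K₂ → Type} {R : Type}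

/-- The stacks of two machines side by side. -/
def joinStacks (S₁ : ∀ k, List (Γ₁ k)) (S₂ : ∀ k, List (Γ₂ k)) :
    ∀ k : K₁ ⊕ K₂, List (Sum.elim Γ₁ Γ₂ k)
  | .inl k => S₁ k
  | .inr k => S₂ k

theorem update_joinStacks_inl [DecidableEq K₁] [DecidableEq K₂] (S₁ : ∀ k, List (Γ₁ k))
    (S₂ : ∀ k, List (Γ₂ k)) (k : K₁) (l : List (Γ₁ k)) :
    update (joinStacks S₁ S₂) (.inl k) l = joinStacks (update S₁ k l) S₂ := by
  funext k'
  rcases k' with k' | k'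
  · by_cases h : k' = k
    · subst h
      exact (update_self (Sum.inl k') _ _).trans (update_self k' l S₁).symm
    · have h' := update_of_ne h l S₁
      exact (update_of_ne (by simpa using h) _ _).trans h'.symm
  · exact update_of_ne (by simp) _ _

theorem update_joinStacks_inr [DecidableEq K₁] [DecidableEq K₂] (S₁ : ∀ k, List (Γ₁ k))
    (S₂ : ∀ k, List (Γ₂ k)) (k : K₂) (l : List (Γ₂ k)) :
    update (joinStacks S₁ S₂) (.inr k) l = joinStacks S₁ (update S₂ k l) := by
  funext k'
  rcases k' with k' | k'
  · exact update_of_ne (by simp) _ _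
  · by_cases h : k' = k
    · subst h
      exact (update_self (Sum.inr k') _ _).trans (update_self k' l S₂).symm
    · have h' := update_of_ne h l S₂
      exact (update_of_ne (by simpa using h) _ _).trans h'.symm

/-- A statement of a machine as a statement of a machine with more stacks, more labels and a
larger internal state; instead of halting it goes to the label `start`. -/
def liftStmt {Λ₁ Λ₂ σ τ : Type} (start : Λ₂) :
    TM2.Stmt Γ₁ Λ₁ σ → TM2.Stmt (Sum.elim Γ₁ Γ₂) (Λ₁ ⊕ Λ₂) (σ × τ)
  | .push k f q => .push (.inl k) (fun s => f s.1) (liftStmt start q)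
  | .peek k f q => .peek (.inl k) (fun s o => (f s.1 o, s.2)) (liftStmt start q)
  | .pop k f q => .pop (.inl k) (fun s o => (f s.1 o, s.2)) (liftStmt start q)
  | .load f q => .load (fun s => (f s.1, s.2)) (liftStmt start q)
  | .branch f q q' => .branch (fun s => f s.1) (liftStmt start q) (liftStmt start q')
  | .goto f => .goto fun s => .inl (f s.1)
  | .halt => .goto fun _ => .inr start

/-- The configuration of the larger machine that corresponds to a configuration. -/
def liftCfg {Λ₁ Λ₂ σ τ : Type} (start : Λ₂) (x : τ) (S₂ : ∀ k, List (Γ₂ k))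
    (c : TM2.Cfg Γ₁ Λ₁ σ) : TM2.Cfg (Sum.elim Γ₁ Γ₂) (Λ₁ ⊕ Λ₂) (σ × τ) where
  l := some (match c.l with
    | none => .inr start
    | some l => .inl l)
  var := (c.var, x)
  stk := joinStacks c.stk S₂

theorem stepAux_liftStmt [DecidableEq K₁] [DecidableEq K₂] {Λ₁ Λ₂ σ τ : Type} (start : Λ₂) (x : τ)
    (S₂ : ∀ k, List (Γ₂ k)) (q : TM2.Stmt Γ₁ Λ₁ σ) (v : σ) (S₁ : ∀ k, List (Γ₁ k)) :
    TM2.stepAux (liftStmt start q) (v, x) (joinStacks S₁ S₂) =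
      liftCfg start x S₂ (TM2.stepAux q v S₁) := by
  induction q generalizing v S₁ with
  | push k f q ih =>
    simp only [liftStmt, TM2.stepAux, ← ih]
    rw [← update_joinStacks_inl]; rfl
  | peek k f q ih => simp only [liftStmt, TM2.stepAux, ← ih]; rfl
  | pop k f q ih =>
    simp only [liftStmt, TM2.stepAux, ← ih]
    rw [← update_joinStacks_inl]; rfl
  | load f q ih => simp only [liftStmt, TM2.stepAux, ← ih]
  | branch f q q' ih ih' =>
    cases h : f v
    · simpa only [liftStmt, TM2.stepAux, h, cond_false] using ih' v S₁
    · simpa only [liftStmt, TM2.stepAux, h, cond_true] using ih v S₁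
  | goto f => rfl
  | halt => rfl

/-- A run of a machine is also one of the larger machine. -/
theorem StepsTo.lift [DecidableEq K₁] [DecidableEq K₂] {Λ₁ Λ₂ σ τ : Type} {start : Λ₂}
    {m : Λ₁ → TM2.Stmt Γ₁ Λ₁ σ} {M : Λ₁ ⊕ Λ₂ → TM2.Stmt (Sum.elim Γ₁ Γ₂) (Λ₁ ⊕ Λ₂) (σ × τ)}
    (hM : ∀ l, M (.inl l) = liftStmt start (m l)) (x : τ) (S₂ : ∀ k, List (Γ₂ k)) {t : ℕ}
    {c c' : TM2.Cfg Γ₁ Λ₁ σ} (h : StepsTo m t c c') :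
    StepsTo M t (liftCfg start x S₂ c) (liftCfg start x S₂ c') := by
  induction t generalizing c with
  | zero =>
    simp only [StepsTo, iterate_zero, id, Option.some.injEq] at h
    subst h; rfl
  | succ t ih =>
    obtain ⟨l, v, S⟩ := c
    rw [StepsTo, iterate_succ_apply] at h
    cases l with
    | none =>
      exfalso
      have : ∀ n, (flip bind (TM2.step m))^[n] none = none := fun n =>
        iterate_fixed rfl n
      simp only [flip, Option.bind_eq_bind, Option.bind_some, TM2.step] at h
      exact absurd ((this t).symm.trans h) (by simp)
    | some l =>
      have h' : StepsTo m t (TM2.stepAux (m l) v S) c' := h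
      rw [Nat.add_comm]
      refine StepsTo.trans (.one ?_) (ih h')
      simp only [liftCfg, TM2.step, hM, stepAux_liftStmt]

/-- The number of `push` instructions in a statement. -/
def pushCount {Λ₁ σ : Type} : TM2.Stmt Γ₁ Λ₁ σ → ℕ
  | .push _ _ q => pushCount q + 1
  | .peek _ _ q => pushCount q
  | .pop _ _ q => pushCount q
  | .load _ q => pushCount q
  | .branch _ q q' => pushCount q + pushCount q'
  | .goto _ => 0
  | .halt => 0

theorem length_stepAux_le [DecidableEq K₁] {Λ₁ σ : Type} (q : TM2.Stmt Γ₁ Λ₁ σ) (v : σ)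
    (S : ∀ k, List (Γ₁ k)) (k : K₁) :
    ((TM2.stepAux q v S).stk k).length ≤ (S k).length + pushCount q := by
  induction q generalizing v S with
  | push k' f q ih =>
    refine (ih _ _).trans ?_
    by_cases h : k = k'
    · subst h; simp [pushCount]; omega
    · simp [pushCount, h]
  | peek k' f q ih => exact ih _ _
  | pop k' f q ih =>
    refine (ih _ _).trans ?_
    by_cases h : k = k'
    · subst h; simp [pushCount]
    · simp [pushCount, h]
  | load f q ih => exact ih _ _
  | branch f q q' ih ih' =>
    simp only [TM2.stepAux, pushCount]
    cases f v
    · exact (ih' _ _).trans (by omega)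
    · exact (ih _ _).trans (by omega)
  | goto f => simp [pushCount]
  | halt => simp [pushCount]

/-- A machine run for `t` steps makes its stacks longer by at most `b * t`. -/
theorem length_le_of_stepsTo [DecidableEq K₁] {Λ₁ σ : Type} {m : Λ₁ → TM2.Stmt Γ₁ Λ₁ σ} {b : ℕ}
    (hb : ∀ l, pushCount (m l) ≤ b) {t : ℕ} {c c' : TM2.Cfg Γ₁ Λ₁ σ} (h : StepsTo m t c c')
    (k : K₁) : (c'.stk k).length ≤ (c.stk k).length + b * t := by
  induction t generalizing c' with
  | zero =>
    simp only [StepsTo, iterate_zero, id, Option.some.injEq] at h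
    subst h; simp
  | succ t ih =>
    rw [StepsTo, iterate_succ_apply'] at h
    obtain ⟨d, hd, hd'⟩ := Option.bind_eq_some_iff.1 h
    have h1 := ih hd
    obtain ⟨l, v, S⟩ := d
    cases l with
    | none => simp [TM2.step] at hd'
    | some l =>
      simp only [TM2.step, Option.some.injEq] at hd'
      subst hd'
      have := length_stepAux_le (m l) v S k
      have := hb l
      simp only at h1
      rw [Nat.mul_succ]; omega

end Composition

section ProgMachine

variable (M : FinTM2) {K₂ : Type} [DecidableEq K₂] [Fintype K₂] {Γ₂ : K₂ → Type} {R : Type}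
  [Fintype R] (p : Prog (Sum.elim M.Γ Γ₂) R) (out : K₂)

/-- The machine that runs `M`, and then the program `p` on the stacks of `M` and some further
stacks; the output stack is `out`. -/
noncomputable def progMachine : FinTM2 where
  K := M.K ⊕ K₂
  kDecidableEq := instDecidableEqSum
  kFin := @instFintypeSum _ _ M.kFin _
  k₀ := .inl M.k₀
  k₁ := .inr out
  Γ := Sum.elim M.Γ Γ₂
  Λ := M.Λ ⊕ Option p.Lab
  main := .inl M.main
  ΛFin := by
    have := M.ΛFin
    have := p.finite_lab
    exact Fintype.ofFinite _
  σ := M.σ × Option R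
  initialState := (M.initialState, none)
  σFin := by
    have := M.σFin
    exact inferInstance
  Γk₀Fin := M.Γk₀Fin
  m
    | .inl l => liftStmt (some p.entry) (M.m l)
    | .inr (some l) => p.code (.inr none) (fun l => .inr (some l)) l
    | .inr none => .load (fun _ => (M.initialState, none)) .halt

/-- The stacks of `M` after it has halted with the output `y`. -/
def haltStacks (y : List (M.Γ M.k₁)) (k : M.K) : List (M.Γ k) := (haltList M y).stk k

/-- A program that computes the stack contents `z` from the output of `M`, and leaves all other
stacks empty, turns `M` into a machine with the output `z`. -/
theorem progMachine_outputsInTime (x : List (M.Γ M.k₀)) (y : List (M.Γ M.k₁)) (z : List (Γ₂ out))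
    {t t' : ℕ} (h : TM2OutputsInTime M x (some y) t)
    (h' : p.Runs (joinStacks (haltStacks M y) fun _ => [])
      (joinStacks (fun _ => []) (update (fun _ => []) out z)) t') :
    Nonempty (TM2OutputsInTime (progMachine M p out) x (some z) (t + t' + 1)) := by
  obtain ⟨⟨s, hs⟩, hst⟩ := h
  have h1 : StepsTo M.m s (initList M x) (haltList M y) := hs
  have h2 := StepsTo.lift (M := (progMachine M p out).m) (start := some p.entry) (Γ₂ := Γ₂)
    (τ := Option R) (fun l => rfl) none (fun _ => []) h1
  obtain ⟨r, h3⟩ := h'.stepsTo (progMachine M p out).m (.inr none) (fun l => .inr (some l))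
    (fun l => rfl) M.initialState none
  have h4 : StepsTo (progMachine M p out).m 1 ⟨some (.inr none), (M.initialState, r),
      joinStacks (fun _ => []) (update (fun _ => []) out z)⟩
      ⟨none, (M.initialState, none), joinStacks (fun _ => []) (update (fun _ => []) out z)⟩ :=
    .one rfl
  have e1 : initList (progMachine M p out) x =
      liftCfg (some p.entry) none (fun _ => []) (initList M x) := by
    refine congrArg (fun S => (⟨some (.inl M.main), (M.initialState, none), S⟩ :
      TM2.Cfg (Sum.elim M.Γ Γ₂) (M.Λ ⊕ Option p.Lab) (M.σ × Option R))) (funext fun k => ?_)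
    rcases k with k | k
    · by_cases hk : k = M.k₀
      · subst hk
        have h0 : (initList M x).stk M.k₀ = x := dif_pos rfl
        exact (dif_pos rfl).trans h0.symm
      · have h0 : (initList M x).stk k = [] := dif_neg hk
        exact (dif_neg fun h => hk (Sum.inl.inj h)).trans h0.symm
    · exact dif_neg (by rintro ⟨⟩)
  have e2 : haltList (progMachine M p out) z =
      ⟨none, (M.initialState, none), joinStacks (fun _ => []) (update (fun _ => []) out z)⟩ := by
    refine congrArg (fun S => (⟨none, (M.initialState, none), S⟩ :
      TM2.Cfg (Sum.elim M.Γ Γ₂) (M.Λ ⊕ Option p.Lab) (M.σ × Option R))) (funext fun k => ?_)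
    rcases k with k | k
    · exact dif_neg (by rintro ⟨⟩)
    · by_cases hk : k = out
      · subst hk
        exact (dif_pos rfl).trans (update_self k z fun k => ([] : List (Γ₂ k))).symm
      · have h0 := update_of_ne hk z fun k => ([] : List (Γ₂ k))
        exact (dif_neg fun h => hk (Sum.inr.inj h)).trans h0.symm
  have h5 := (h2.trans h3).trans h4
  replace hst : s ≤ t := hst
  refine ⟨⟨⟨s + t' + 1, ?_⟩, show s + t' + 1 ≤ t + t' + 1 by omega⟩⟩
  rw [e1]
  exact Eq.trans h5 (congrArg some e2.symm)

/-- The output of a machine is longer than its input by at most a constant times the running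
time. -/
theorem exists_length_output_le : ∃ b : ℕ, ∀ (x : List (M.Γ M.k₀)) (y : List (M.Γ M.k₁)) (t : ℕ),
    Nonempty (TM2OutputsInTime M x (some y) t) → y.length ≤ x.length + b * t := by
  have := M.ΛFin
  refine ⟨∑ l, pushCount (M.m l), ?_⟩
  rintro x y t ⟨⟨s, hs⟩, hst⟩
  have h := length_le_of_stepsTo
    (fun l => Finset.single_le_sum (f := fun l => pushCount (M.m l)) (fun _ _ => Nat.zero_le _)
      (Finset.mem_univ l)) (show StepsTo M.m s (initList M x) (haltList M y) from hs) M.k₁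
  have h1 : ((haltList M y).stk M.k₁) = y := by simp [haltList]
  have h2 : ((initList M x).stk M.k₁).length ≤ x.length := by
    unfold initList
    dsimp only
    split_ifs with h
    · have : ∀ (k : M.K) (h : k = M.k₀) (h' : List (M.Γ k) = List (M.Γ M.k₀)),
          (h'.mpr x).length ≤ x.length := by
        rintro k rfl _; exact le_rfl
      exact this _ h _
    · simp
  rw [h1] at h
  have := Nat.mul_le_mul_left (∑ l, pushCount (M.m l)) (show s ≤ t from hst)
  omega

end ProgMachine

/-! ### A program that prints the graph -/

/-- The work stacks of the program. -/
inductive Stk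
  /-- the bits of the word, in reverse order -/
  | a
  /-- a stack to which other stacks are moved, and a copy of the word whose length is counted -/
  | b | c
  /-- the marks of the positions, and a stack to which they are moved in a scan -/
  | B | B'
  /-- the marks of the positions whose rows have not been printed -/
  | P
  /-- the window: how near the positions are to the position whose row is printed. The parts of
  the window to the left and to the right of the first position, and a stack to which the latter
  is moved in a scan -/
  | L | W | W'
  /-- the output in reverse order, and the output -/
  | rev | out
  deriving DecidableEq

instance : Fintype Stk :=
  ⟨{.a, .b, .c, .B, .B', .P, .L, .W, .W', .rev, .out}, by rintro ⟨⟩ <;> simp⟩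

/-- The alphabets of the work stacks. In the window `none` stands for the position whose row is
printed, `some true` and `some false` for other positions that are near and that are far away. -/
abbrev StkΓ : Stk → Type
  | .rev => Bool
  | .out => Bool
  | _ => Option Bool

/-- The contents of the stacks; `inp` is the output stack of the preceding machine. -/
structure Mem (α : Type) where
  inp : List α
  a : List (Option Bool) := []
  b : List (Option Bool) := []
  c : List (Option Bool) := []
  B : List (Option Bool) := []
  B' : List (Option Bool) := []
  P : List (Option Bool) := []
  L : List (Option Bool) := []
  W : List (Option Bool) := []
  W' : List (Option Bool) := []
  rev : List Bool := []
  out : List Bool := []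

namespace Mem

variable {α : Type}

def get (m : Mem α) : (k : Stk) → List (StkΓ k)
  | .a => m.a
  | .b => m.b
  | .c => m.c
  | .B => m.B
  | .B' => m.B'
  | .P => m.P
  | .L => m.L
  | .W => m.W
  | .W' => m.W'
  | .rev => m.rev
  | .out => m.out

def set (m : Mem α) : (k : Stk) → List (StkΓ k) → Mem α
  | .a, l => { m with a := l }
  | .b, l => { m with b := l }
  | .c, l => { m with c := l }
  | .B, l => { m with B := l }
  | .B', l => { m with B' := l }
  | .P, l => { m with P := l }
  | .L, l => { m with L := l }
  | .W, l => { m with W := l }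
  | .W', l => { m with W' := l }
  | .rev, l => { m with rev := l }
  | .out, l => { m with out := l }

theorem get_set (m : Mem α) (k : Stk) (l : List (StkΓ k)) : (m.set k l).get = update m.get k l := by
  funext k'
  cases k <;> cases k' <;> rfl

theorem inp_set (m : Mem α) (k : Stk) (l : List (StkΓ k)) : (m.set k l).inp = m.inp := by
  cases k <;> rfl

end Mem

section

variable (M : FinTM2)

/-- The programs that run on the output of the machine `M`. -/
abbrev GProg : Type := Prog (Sum.elim M.Γ StkΓ) (Option Bool)

variable {M}

/-- The stacks of the whole machine; those of `M` are empty except for its output stack. -/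
def memStacks (m : Mem (M.Γ M.k₁)) : ∀ k : M.K ⊕ Stk, List (Sum.elim M.Γ StkΓ k) :=
  joinStacks (haltStacks M m.inp) m.get

/-- The program `p` changes the contents of the stacks from `m` to `m'` in time at most `t`. -/
def Does (p : GProg M) (m m' : Mem (M.Γ M.k₁)) (t : ℕ) : Prop :=
  ∃ t' ≤ t, p.Runs (memStacks m) (memStacks m') t'

theorem update_stacks (m : Mem (M.Γ M.k₁)) (k : Stk) (l : List (StkΓ k)) :
    update (memStacks m) (.inr k) l = memStacks (m.set k l) := by
  rw [memStacks, update_joinStacks_inr, memStacks, Mem.get_set, Mem.inp_set]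

theorem update_stacks_inp (m : Mem (M.Γ M.k₁)) (l : List (M.Γ M.k₁)) :
    update (memStacks m) (.inl M.k₁) l = memStacks { m with inp := l } := by
  rw [memStacks, update_joinStacks_inl, memStacks]
  congr 1
  funext k
  by_cases hk : k = M.k₁
  · subst hk
    have h0 : haltStacks M l M.k₁ = l := dif_pos rfl
    exact (update_self _ _ _).trans h0.symm
  · have h0 : haltStacks M l k = [] := dif_neg hk
    have h1 : haltStacks M m.inp k = [] := dif_neg hk
    exact (update_of_ne hk _ _).trans (h1.trans h0.symm)

namespace Does

variable {p q : GProg M} {m m' m'' : Mem (M.Γ M.k₁)} {t t' : ℕ}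

theorem mono (h : Does p m m' t) (ht : t ≤ t') : Does p m m' t' := by
  obtain ⟨s, hs, h⟩ := h
  exact ⟨s, hs.trans ht, h⟩

theorem skip : Does (.skip : GProg M) m m 1 := ⟨1, le_rfl, .skip⟩

theorem push (k : Stk) (a : StkΓ k) :
    Does (.push (.inr k) a : GProg M) m (m.set k (a :: m.get k)) 1 := by
  refine ⟨1, le_rfl, ?_⟩
  rw [← update_stacks]
  exact .push

theorem seq (h : Does p m m' t) (h' : Does q m' m'' t') : Does (.seq p q) m m'' (t + t') := by
  obtain ⟨s, hs, h⟩ := h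
  obtain ⟨s', hs', h'⟩ := h'
  exact ⟨s + s', by omega, .seq h h'⟩

theorem ifpop {k : Stk} {dec : StkΓ k → Option Bool} {q : Option Bool → GProg M} {a : StkΓ k}
    {l : List (StkΓ k)} (hk : m.get k = a :: l) (h : Does (q (dec a)) (m.set k l) m' t) :
    Does (.ifpop (.inr k) dec p q) m m' (1 + t) := by
  obtain ⟨s, hs, h⟩ := h
  rw [← update_stacks] at h
  exact ⟨1 + s, by omega, .ifpop_cons hk h⟩

theorem loop_nil {k : Stk} {dec : StkΓ k → Option Bool} {q : Option Bool → GProg M}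
    (hk : m.get k = []) : Does (.loop (.inr k) dec q) m m 1 :=
  ⟨1, le_rfl, .loop_nil hk⟩

theorem loop_cons {k : Stk} {dec : StkΓ k → Option Bool} {q : Option Bool → GProg M} {a : StkΓ k}
    {l : List (StkΓ k)} (hk : m.get k = a :: l) (h : Does (q (dec a)) (m.set k l) m' t)
    (h' : Does (.loop (.inr k) dec q) m' m'' t') :
    Does (.loop (.inr k) dec q) m m'' (1 + t + t') := by
  obtain ⟨s, hs, h⟩ := h
  obtain ⟨s', hs', h'⟩ := h'
  rw [← update_stacks] at h
  exact ⟨1 + s + s', by omega, .loop_cons hk h h'⟩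

theorem loop_inp_nil {dec : M.Γ M.k₁ → Option Bool} {q : Option Bool → GProg M}
    (hm : m.inp = []) : Does (.loop (.inl M.k₁) dec q) m m 1 := by
  refine ⟨1, le_rfl, .loop_nil ?_⟩
  have h0 : haltStacks M m.inp M.k₁ = m.inp := dif_pos rfl
  exact h0.trans hm

theorem loop_inp_cons {dec : M.Γ M.k₁ → Option Bool} {q : Option Bool → GProg M} {a : M.Γ M.k₁}
    {l : List (M.Γ M.k₁)} (hm : m.inp = a :: l)
    (h : Does (q (dec a)) { m with inp := l } m' t)
    (h' : Does (.loop (.inl M.k₁) dec q) m' m'' t') :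
    Does (.loop (.inl M.k₁) dec q) m m'' (1 + t + t') := by
  obtain ⟨s, hs, h⟩ := h
  obtain ⟨s', hs', h'⟩ := h'
  rw [← update_stacks_inp] at h
  refine ⟨1 + s + s', by omega, .loop_cons ?_ h h'⟩
  have h0 : haltStacks M m.inp M.k₁ = m.inp := dif_pos rfl
  exact h0.trans hm

end Does

/-- Loops in which an element of the stack `k` costs time at most `t`: the state of the memory is
given by what has already been popped, in reverse order, and by what has not. -/
theorem Does.loop {k : Stk} {dec : StkΓ k → Option Bool} {q : Option Bool → GProg M} {t : ℕ}
    (F : List (StkΓ k) → List (StkΓ k) → Mem (M.Γ M.k₁)) (hF : ∀ l₁ l₂, (F l₁ l₂).get k = l₂)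
    (h : ∀ l₁ a l₂, Does (q (dec a)) ((F l₁ (a :: l₂)).set k l₂) (F (a :: l₁) l₂) t)
    (l : List (StkΓ k)) :
    Does (.loop (.inr k) dec q) (F [] l) (F l.reverse []) (l.length * (t + 1) + 1) := by
  have key : ∀ l₁, Does (.loop (.inr k) dec q) (F l₁ l) (F (l.reverse ++ l₁) [])
      (l.length * (t + 1) + 1) := by
    induction l with
    | nil => exact fun l₁ => (Does.loop_nil (hF _ _)).mono (by simp)
    | cons a l ih =>
      intro l₁
      have := Does.loop_cons (hF l₁ (a :: l)) (h l₁ a l) (ih (a :: l₁))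
      rw [List.reverse_cons, List.append_assoc]
      refine this.mono ?_
      rw [List.length_cons, Nat.succ_mul]; omega
  simpa using key []

end

/-! #### The parts of the program -/

section

variable {M : FinTM2}

/-- Move the contents of one stack to another one. -/
def moveTo (k k' : Stk) (dec : StkΓ k → Option Bool) (enc : Option Bool → StkΓ k') : GProg M :=
  .loop (.inr k) dec fun x => .push (.inr k') (enc x)

/-- Print a number that is `0` or `1`, in unary. -/
def emitBit (b : Bool) : GProg M :=
  if b then .seq (.push (.inr .rev) true) (.push (.inr .rev) false)
  else .push (.inr .rev) false

theorem does_emitBit (b : Bool) (m : Mem (M.Γ M.k₁)) :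
    Does (emitBit b) m { m with rev := (unary [b.toNat]).reverse ++ m.rev } 2 := by
  cases b
  · exact (Does.push .rev false).mono (by omega)
  · exact (Does.push .rev true).seq (Does.push .rev false)

/-- The entry of the adjacency matrix for two vertices that are the first (`false`) or the second
(`true`) vertex at their positions, where the window contains `ch`. -/
def entry (κ κ' : Bool) (ch : Option Bool) : Bool :=
  ch.getD (κ != κ')

/-- The row of the adjacency matrix that belongs to a first or second vertex at a position, for
the marks `l` and the window `r`. -/
def rowList (κ : Bool) : List (Option Bool) → List (Option Bool) → List ℕ
  | x :: l, ch :: r => (entry κ false ch).toNat ::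
      ((if x = some true then [(entry κ true ch).toNat] else []) ++ rowList κ l r)
  | _, _ => []

/-- Print a row of the adjacency matrix. -/
def printRow (κ : Bool) : GProg M :=
  .seq (.loop (.inr .B) id fun x => .seq (.push (.inr .B') x)
    (.ifpop (.inr .W) id .skip fun ch => .seq (.push (.inr .W') ch)
      (.seq (emitBit (entry κ false ch))
        (if x = some true then emitBit (entry κ true ch) else .skip))))
  (.seq (moveTo .B' .B id id) (moveTo .W' .W id id))

theorem does_printRow_scan (κ : Bool) (l r r' : List (Option Bool)) (hr : r.length = l.length)
    (m : Mem (M.Γ M.k₁)) (hB : m.B = l) (hW : m.W = r ++ r') :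
    Does (.loop (.inr .B) id fun x => .seq (.push (.inr .B') x)
      (.ifpop (.inr .W) id .skip fun ch => .seq (.push (.inr .W') ch)
      (.seq (emitBit (entry κ false ch))
        (if x = some true then emitBit (entry κ true ch) else .skip)))) m
      { m with B := [], B' := l.reverse ++ m.B', W := r', W' := r.reverse ++ m.W',
               rev := (unary (rowList κ l r)).reverse ++ m.rev } (l.length * 8 + 1) := by
  induction l generalizing r m with
  | nil =>
    obtain rfl : r = [] := List.length_eq_zero_iff.1 hr
    obtain ⟨_, _, _, _, _, _, _, _, _, _, _, _⟩ := m
    simp only at hB hW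
    subst hB hW
    exact (Does.loop_nil rfl).mono (by simp)
  | cons x l ih =>
    rcases r with _ | ⟨ch, r⟩
    · simp at hr
    simp only [List.length_cons, Nat.add_right_cancel_iff] at hr
    obtain ⟨inp, a, b, c, B, B', P, L, W, W', rev, out⟩ := m
    simp only at hB hW
    subst hB hW
    have h1 : Does (if x = some true then emitBit (entry κ true ch) else .skip)
        ⟨inp, a, b, c, l, x :: B', P, L, r ++ r', ch :: W',
          (unary [(entry κ false ch).toNat]).reverse ++ rev, out⟩
        ⟨inp, a, b, c, l, x :: B', P, L, r ++ r', ch :: W',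
          (unary ((entry κ false ch).toNat ::
            if x = some true then [(entry κ true ch).toNat] else [])).reverse ++ rev, out⟩ 2 := by
      split_ifs with hx
      · convert does_emitBit _ _ using 2
        simp [unary]
      · exact Does.skip.mono (by omega)
    have h2 := Does.loop_cons (m := ⟨inp, a, b, c, x :: l, B', P, L, ch :: r ++ r', W', rev, out⟩)
      (q := fun x => .seq (.push (.inr .B') x)
      (.ifpop (.inr .W) id .skip fun ch => .seq (.push (.inr .W') ch)
      (.seq (emitBit (entry κ false ch))
        (if x = some true then emitBit (entry κ true ch) else .skip)))) (k := .B) (dec := id) rfl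
      (Does.seq (Does.push .B' x) (Does.ifpop (k := .W) rfl (Does.seq (Does.push .W' ch)
        (Does.seq (does_emitBit _ _) h1)))) (ih r hr _ rfl rfl)
    have e : (unary (rowList κ (x :: l) (ch :: r))).reverse = (unary (rowList κ l r)).reverse ++
        (unary ((entry κ false ch).toNat ::
          if x = some true then [(entry κ true ch).toNat] else [])).reverse := by
      rw [← List.reverse_append, rowList, ← List.cons_append]
      simp only [unary, List.flatMap_append]
    simp only [e, List.reverse_cons, List.append_assoc, List.singleton_append]
    refine h2.mono ?_
    simp only [List.length_cons]; omega

theorem does_printRow (κ : Bool) (l r r' : List (Option Bool)) (hr : r.length = l.length)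
    (m : Mem (M.Γ M.k₁)) (hB : m.B = l) (hW : m.W = r ++ r') (hB' : m.B' = []) (hW' : m.W' = []) :
    Does (printRow κ) m { m with rev := (unary (rowList κ l r)).reverse ++ m.rev }
      (l.length * 12 + 3) := by
  obtain ⟨inp, a, b, c, B, B', P, L, W, W', rev, out⟩ := m
  simp only at hB hW hB' hW'
  subst hB hW hB' hW'
  have h1 := does_printRow_scan (M := M) κ B r r' hr
    ⟨inp, a, b, c, B, [], P, L, r ++ r', [], rev, out⟩ rfl rfl
  have h2 := Does.loop (M := M) (k := .B') (dec := id) (q := fun x => .push (.inr .B) x)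
    (fun l₁ l₂ => ⟨inp, a, b, c, l₁, l₂, P, L, r', r.reverse,
      (unary (rowList κ B r)).reverse ++ rev, out⟩) (fun _ _ => rfl)
    (fun _ _ _ => Does.push .B _) B.reverse
  have h3 := Does.loop (M := M) (k := .W') (dec := id) (q := fun x => .push (.inr .W) x)
    (fun l₁ l₂ => ⟨inp, a, b, c, B, [], P, L, l₁ ++ r', l₂, (unary (rowList κ B r)).reverse ++ rev,
      out⟩) (fun _ _ => rfl) (fun _ _ _ => Does.push .W _) r.reverse
  simp only [List.append_nil] at h1
  simp only [List.reverse_reverse] at h2 h3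
  refine (h1.seq (h2.seq h3)).mono ?_
  simp only [List.length_reverse, hr]; omega

end

/-! #### The adjacency matrix -/

theorem unary_append (l l' : List ℕ) : unary (l ++ l') = unary l ++ unary l' :=
  List.flatMap_append

/-- What the window contains at the position `q` while the row of the position `p` is printed. -/
def windowAt (D p q : ℕ) : Option Bool :=
  if p = q then none else some (decide (p < q + D ∧ q < p + D))

/-- The vertices at the positions from `p` on, for a list of marks: a first vertex at each
position and a second one at each marked position. -/
def vertices : ℕ → List Bool → List (ℕ × Bool)
  | _, [] => []
  | p, x :: l => (p, false) :: ((if x then [(p, true)] else []) ++ vertices (p + 1) l)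

/-- Whether two vertices are adjacent. -/
def adjBit (D : ℕ) (u v : ℕ × Bool) : Bool := entry u.2 v.2 (windowAt D u.1 v.1)

theorem rowList_eq (D p : ℕ) (κ : Bool) (l : List Bool) (q : ℕ) :
    rowList κ (l.map some) ((List.range' q l.length).map (windowAt D p)) =
      (vertices q l).map fun v => (adjBit D (p, κ) v).toNat := by
  induction l generalizing q with
  | nil => rfl
  | cons x l ih =>
    simp only [List.map_cons, List.length_cons, List.range'_succ, rowList, ih, vertices,
      List.map_append, adjBit]
    cases x <;> simp

/-- The window to the left of the first position. -/
def leftWindow (D n : ℕ) : List (Option Bool) :=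
  (List.range n).map fun i => some (decide (i + 1 < D))

theorem take_window {D n M p : ℕ} (hD : 0 < D) (hM : M ≤ n) (hp : p < M) :
    (((leftWindow D n).take p).reverse ++ none :: leftWindow D n).take M =
      (List.range' 0 M).map (windowAt D p) := by
  apply List.ext_getElem
  · simp [leftWindow]; omega
  · intro q h1 h2
    simp only [List.length_map, List.length_range'] at h2
    simp only [List.getElem_take, List.getElem_map, List.getElem_range', Nat.zero_add, Nat.one_mul]
    rw [List.getElem_append]
    split_ifs with h
    · simp only [leftWindow, List.length_reverse, List.length_take, List.length_map,
        List.length_range] at h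
      simp only [leftWindow, List.getElem_reverse, List.getElem_take, List.getElem_map,
        List.getElem_range, List.length_take, List.length_map, List.length_range, windowAt]
      rw [if_neg (by omega)]
      congr 2
      simp only [eq_iff_iff]
      omega
    · simp only [leftWindow, List.length_reverse, List.length_take, List.length_map,
        List.length_range] at h
      rw [List.getElem_cons]
      split_ifs with h'
      · simp only [leftWindow, List.length_reverse, List.length_take, List.length_map,
          List.length_range] at h'
        rw [windowAt, if_pos (by omega)]
      · simp only [leftWindow, List.length_reverse, List.length_take, List.length_map,
          List.length_range] at h'
        simp only [leftWindow, List.getElem_map, List.getElem_range, List.length_reverse,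
          List.length_take, List.length_map, List.length_range, windowAt]
        rw [if_neg (by omega)]
        congr 2
        simp only [eq_iff_iff]
        omega

/-- The entries of the adjacency matrix in the rows of the vertices at the positions from `p` on. -/
def matrixFrom (D p : ℕ) (l l₀ : List Bool) : List ℕ :=
  (vertices p l).flatMap fun u => (vertices 0 l₀).map fun v => (adjBit D u v).toNat

section

variable {M : FinTM2}

/-- Print the adjacency matrix. -/
def printMatrix : GProg M :=
  .loop (.inr .P) id fun x => .seq (printRow false)
    (.seq (if x = some true then printRow true else .skip)
      (.ifpop (.inr .L) id .skip fun ch => .push (.inr .W) ch))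

theorem does_printMatrix {D n : ℕ} (hD : 0 < D) (l₀ : List Bool) (hn : l₀.length ≤ n)
    (l : List Bool) (p : ℕ) (hp : p + l.length = l₀.length) (rev : List Bool) :
    Does (M := M) printMatrix
      { inp := [], P := l.map some, B := l₀.map some, L := (leftWindow D n).drop p,
        W := ((leftWindow D n).take p).reverse ++ none :: leftWindow D n, rev := rev }
      { inp := [], B := l₀.map some, L := (leftWindow D n).drop l₀.length,
        W := ((leftWindow D n).take l₀.length).reverse ++ none :: leftWindow D n,
        rev := (unary (matrixFrom D p l l₀)).reverse ++ rev }
      (l.length * (24 * l₀.length + 9) + 1) := by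
  induction l generalizing p rev with
  | nil =>
    simp only [List.length_nil, Nat.add_zero] at hp
    subst hp
    exact (Does.loop_nil rfl).mono (by simp)
  | cons x l ih =>
    simp only [List.length_cons] at hp
    set W := ((leftWindow D n).take p).reverse ++ none :: leftWindow D n with hW
    have hlen : n = (leftWindow D n).length := by simp [leftWindow]
    have hWlen : l₀.length ≤ W.length := by
      rw [hW, List.length_append, List.length_cons, ← hlen]; omega
    have hrow : ∀ κ rev, Does (M := M) (printRow κ)
        { inp := [], P := l.map some, B := l₀.map some, L := (leftWindow D n).drop p,
          W := W, rev := rev }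
        { inp := [], P := l.map some, B := l₀.map some, L := (leftWindow D n).drop p,
          W := W, rev := (unary ((vertices 0 l₀).map fun v =>
            (adjBit D (p, κ) v).toNat)).reverse ++ rev } (l₀.length * 12 + 3) := by
      intro κ rev
      rw [← rowList_eq, ← take_window hD hn (by omega), ← hW]
      have := does_printRow (M := M) κ (l₀.map some) (W.take l₀.length) (W.drop l₀.length)
        (by simpa using hWlen)
        { inp := [], P := l.map some, B := l₀.map some, L := (leftWindow D n).drop p,
          W := W, rev := rev } rfl (List.take_append_drop _ _).symm rfl rfl
      rwa [List.length_map] at this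
    have hsnd : Does (M := M) (if some x = some true then printRow true else .skip)
        { inp := [], P := l.map some, B := l₀.map some, L := (leftWindow D n).drop p,
          W := W, rev := (unary ((vertices 0 l₀).map fun v =>
            (adjBit D (p, false) v).toNat)).reverse ++ rev }
        { inp := [], P := l.map some, B := l₀.map some, L := (leftWindow D n).drop p,
          W := W, rev := (unary (((p, false) :: if x then [(p, true)] else []).flatMap fun u =>
            (vertices 0 l₀).map fun v => (adjBit D u v).toNat)).reverse ++ rev }
        (l₀.length * 12 + 3) := by
      cases x
      · rw [if_neg (by simp)]
        simp only [Bool.false_eq_true, if_false, List.flatMap_cons, List.flatMap_nil,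
          List.append_nil]
        exact Does.skip.mono (by omega)
      · rw [if_pos rfl]
        have := hrow true ((unary ((vertices 0 l₀).map fun v =>
            (adjBit D (p, false) v).toNat)).reverse ++ rev)
        simp only [if_true, List.flatMap_cons, List.flatMap_nil, List.append_nil]
        rw [unary_append, List.reverse_append, List.append_assoc]
        exact this
    have hdrop : (leftWindow D n).drop p =
        (leftWindow D n)[p]'(by omega) :: (leftWindow D n).drop (p + 1) :=
      List.drop_eq_getElem_cons _
    have htake : (leftWindow D n)[p]'(by omega) :: W =
        ((leftWindow D n).take (p + 1)).reverse ++ none :: leftWindow D n := by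
      rw [List.take_add_one, List.getElem?_eq_getElem (by omega), hW, List.reverse_append]
      rfl
    have hpop : ∀ rev, Does (M := M) (.ifpop (.inr .L) id .skip fun ch => .push (.inr .W) ch)
        { inp := [], P := l.map some, B := l₀.map some, L := (leftWindow D n).drop p,
          W := W, rev := rev }
        { inp := [], P := l.map some, B := l₀.map some, L := (leftWindow D n).drop (p + 1),
          W := ((leftWindow D n).take (p + 1)).reverse ++ none :: leftWindow D n, rev := rev }
        2 := by
      intro rev
      rw [← htake]
      refine Does.ifpop (k := .L) (a := (leftWindow D n)[p]'(by omega))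
        (l := (leftWindow D n).drop (p + 1)) ?_ (Does.push .W _)
      exact hdrop
    have := Does.loop_cons (M := M) (k := .P) (dec := id)
      (m := { inp := [], P := (x :: l).map some, B := l₀.map some, L := (leftWindow D n).drop p,
              W := W, rev := rev })
      (q := fun x => .seq (printRow false) (.seq (if x = some true then printRow true else .skip)
        (.ifpop (.inr .L) id .skip fun ch => .push (.inr .W) ch))) rfl
      ((hrow false rev).seq (hsnd.seq (hpop _))) (ih (p + 1) (by omega) _)
    have e : (unary (matrixFrom D p (x :: l) l₀)).reverse =
        (unary (matrixFrom D (p + 1) l l₀)).reverse ++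
        (unary (((p, false) :: if x then [(p, true)] else []).flatMap fun u =>
            (vertices 0 l₀).map fun v => (adjBit D u v).toNat)).reverse := by
      rw [← List.reverse_append, ← unary_append, matrixFrom, matrixFrom,
        ← List.flatMap_append, vertices, List.cons_append]
    rw [e, List.append_assoc]
    refine this.mono ?_
    rw [List.length_cons, Nat.succ_mul l.length]
    omega

/-- Read the input, add a bit at each end, and make a copy for counting. -/
def prepare (dec : M.Γ M.k₁ → Option Bool) : GProg M :=
  .seq (.push (.inr .a) (some true)) <|
  .seq (.loop (.inl M.k₁) dec fun x => .push (.inr .a) x) <|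
  .seq (.push (.inr .a) (some false)) <|
  .seq (.loop (.inr .a) id fun x => .seq (.push (.inr .b) x) (.push (.inr .c) x))
    (moveTo .b .a id id)

/-- The word whose bits are the labels of the columns. -/
def columnBits (y : List Bool) : List Bool := true :: y ++ [false]

theorem does_prepare {dec : M.Γ M.k₁ → Option Bool} {enc : Bool → M.Γ M.k₁}
    (h : ∀ b, dec (enc b) = some b) (y : List Bool) :
    Does (M := M) (prepare dec) { inp := y.map enc }
      { inp := [], a := ((columnBits y).map some).reverse, c := (columnBits y).map some }
      (7 * (y.length + 2) + 7) := by
  have h1 : ∀ (y : List Bool) (a : List (Option Bool)),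
      Does (M := M) (.loop (.inl M.k₁) dec fun x => .push (.inr .a) x)
        { inp := y.map enc, a := a } { inp := [], a := (y.map some).reverse ++ a }
        (y.length * 2 + 1) := by
    intro y
    induction y with
    | nil => exact fun a => Does.loop_inp_nil rfl
    | cons b y ih =>
      intro a
      have hp : Does (M := M) (.push (.inr .a) (dec (enc b))) { inp := y.map enc, a := a }
          { inp := y.map enc, a := some b :: a } 1 := by
        rw [h]
        exact Does.push .a _
      have := Does.loop_inp_cons (M := M) (m := { inp := (b :: y).map enc, a := a }) (dec := dec)
        (q := fun x => .push (.inr .a) x) rfl hp (ih (some b :: a))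
      have e : (y.map some).reverse ++ some b :: a = ((b :: y).map some).reverse ++ a := by simp
      rw [e] at this
      refine this.mono ?_
      simp only [List.length_cons]; omega
  have h2 := Does.loop (M := M) (k := .a) (dec := id)
    (q := fun x => .seq (.push (.inr .b) x) (.push (.inr .c) x))
    (fun l₁ l₂ => { inp := [], a := l₂, b := l₁, c := l₁ }) (fun _ _ => rfl)
    (fun _ _ _ => (Does.push .b _).seq (Does.push .c _)) ((columnBits y).map some).reverse
  have h3 := Does.loop (M := M) (k := .b) (dec := id)
    (q := fun x => .push (.inr .a) x)
    (fun l₁ l₂ => { inp := [], a := l₁, b := l₂, c := (columnBits y).map some }) (fun _ _ => rfl)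
    (fun _ _ _ => Does.push .a _) ((columnBits y).map some)
  rw [List.reverse_reverse] at h2
  have e : ((columnBits y).map some).reverse =
      some false :: ((y.map some).reverse ++ [some true]) := by
    simp [columnBits]
  have h4 := (Does.push (m := { inp := y.map enc }) .a (some true)).seq
    ((h1 y [some true]).seq (Does.push .a (some false)))
  have h5 := h2.seq h3
  rw [e] at h5
  refine ((Does.push (m := { inp := y.map enc }) .a (some true)).seq
    ((h1 y [some true]).seq ((Does.push .a (some false)).seq (?_ : Does _ _ _
      (5 * (y.length + 2) + 2))))).mono ?_
  · rw [e]
    exact h5.mono (by simp [columnBits]; omega)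
  · omega

/-- Put a position with the given mark on the stacks of marks, and extend the window. -/
def pushMark (x : Bool) : GProg M :=
  .seq (.push (.inr .B) (some x)) <| .seq (.push (.inr .P) (some x)) <|
  .seq (.push (.inr .L) (some false)) (.push (.inr .W) (some false))

/-- The marks of a column that is labelled by a bit. -/
def columnMarks (m : ℕ) (x : Bool) : List Bool := x :: List.replicate (m + 1) false

/-- Put the marks of the columns on the stacks. -/
def pushColumns : GProg M :=
  .loop (.inr .a) id fun x =>
    .seq (.loop (.inr .c) id fun y => .seq (.push (.inr .b) y) (pushMark false)) <|
    .seq (moveTo .b .c id id) <|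
    .seq (pushMark false) (pushMark (x.getD false))

theorem does_pushColumns (w : List Bool) (cs : List (Option Bool)) :
    Does (M := M) pushColumns
      { inp := [], a := (w.map some).reverse, c := cs }
      { inp := [], c := cs, B := (w.flatMap (columnMarks cs.length)).map some,
        P := (w.flatMap (columnMarks cs.length)).map some,
        L := List.replicate (w.length * (cs.length + 2)) (some false),
        W := List.replicate (w.length * (cs.length + 2)) (some false) }
      (w.length * (8 * cs.length + 11) + 1) := by
  have hc : ∀ a B L, Does (M := M)
      (.loop (.inr .c) id fun y => .seq (.push (.inr .b) y) (pushMark false))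
      { inp := [], a := a, c := cs, B := B, P := B, L := L, W := L }
      { inp := [], a := a, b := cs.reverse, B := List.replicate cs.length (some false) ++ B,
        P := List.replicate cs.length (some false) ++ B,
        L := List.replicate cs.length (some false) ++ L,
        W := List.replicate cs.length (some false) ++ L } (cs.length * 6 + 1) := by
    intro a B L
    have := Does.loop (M := M) (k := .c) (dec := id)
      (q := fun y => .seq (.push (.inr .b) y) (pushMark false))
      (t := 1 + 4) (fun l₁ l₂ =>
        { inp := [], a := a, b := l₁, c := l₂,
          B := List.replicate l₁.length (some false) ++ B,
          P := List.replicate l₁.length (some false) ++ B,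
          L := List.replicate l₁.length (some false) ++ L,
          W := List.replicate l₁.length (some false) ++ L }) (fun _ _ => rfl)
      (fun _ _ _ => (Does.push .b _).seq ((Does.push .B _).seq ((Does.push .P _).seq
        ((Does.push .L _).seq (Does.push .W _))))) cs
    simpa using this
  have hb : ∀ a B L, Does (M := M) (moveTo .b .c id id)
      { inp := [], a := a, b := cs.reverse, B := B, P := B, L := L, W := L }
      { inp := [], a := a, c := cs, B := B, P := B, L := L, W := L } (cs.length * 2 + 1) := by
    intro a B L
    have := Does.loop (M := M) (k := .b) (dec := id) (q := fun y => .push (.inr .c) y)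
      (fun l₁ l₂ => { inp := [], a := a, b := l₂, c := l₁, B := B, P := B, L := L, W := L })
      (fun _ _ => rfl) (fun _ _ _ => Does.push .c _) cs.reverse
    rw [List.reverse_reverse, List.length_reverse] at this
    exact this
  have hp : ∀ x a B L, Does (M := M) (pushMark x)
      { inp := [], a := a, c := cs, B := B, P := B, L := L, W := L }
      { inp := [], a := a, c := cs, B := some x :: B, P := some x :: B, L := some false :: L,
        W := some false :: L } 4 := fun x a B L =>
    (Does.push .B _).seq ((Does.push .P _).seq ((Does.push .L _).seq (Does.push .W _)))
  have := Does.loop (M := M) (k := .a) (dec := id)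
    (q := fun x => .seq (.loop (.inr .c) id fun y => .seq (.push (.inr .b) y) (pushMark false)) <|
      .seq (moveTo .b .c id id) <| .seq (pushMark false) (pushMark (x.getD false)))
    (t := cs.length * 6 + 1 + (cs.length * 2 + 1 + (4 + 4)))
    (fun l₁ l₂ =>
      { inp := [], a := l₂, c := cs,
        B := (l₁.flatMap fun x => columnMarks cs.length (x.getD false)).map some,
        P := (l₁.flatMap fun x => columnMarks cs.length (x.getD false)).map some,
        L := List.replicate (l₁.length * (cs.length + 2)) (some false),
        W := List.replicate (l₁.length * (cs.length + 2)) (some false) }) (fun _ _ => rfl)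
    (fun l₁ x l₂ => by
      have := ((hc l₂ ((l₁.flatMap fun x => columnMarks cs.length (x.getD false)).map some)
        (List.replicate (l₁.length * (cs.length + 2)) (some false))).seq
        ((hb _ _ _).seq ((hp false _ _ _).seq (hp (x.getD false) _ _ _))))
      have e : some false :: some false :: (List.replicate cs.length (some false) ++
          List.replicate (l₁.length * (cs.length + 2)) (some false)) =
          List.replicate ((l₁.length + 1) * (cs.length + 2)) (some false) := by
        rw [List.replicate_append_replicate, ← List.replicate_succ, ← List.replicate_succ]
        congr 1
        ring
      rw [e] at this
      simp only [List.flatMap_cons, List.map_append, columnMarks, List.map_cons,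
        List.map_replicate, List.replicate_succ, List.cons_append, List.length_cons]
      simp only [columnMarks, List.replicate_succ] at this
      exact this)
    (w.map some).reverse
  simp only [List.reverse_reverse, List.length_reverse, List.length_map, List.flatMap_map,
    Option.getD_some, List.length_nil, Nat.zero_mul, List.replicate_zero] at this
  refine this.mono (le_of_eq ?_)
  ring

/-- Complete the window: the positions at a distance below the number of copies of `c` plus two
are near. -/
def completeWindow : GProg M :=
  .seq (.loop (.inr .c) id fun _ =>
    .seq (.push (.inr .L) (some true)) (.push (.inr .W) (some true)))
  (.seq (.push (.inr .L) (some true)) (.seq (.push (.inr .W) (some true)) (.push (.inr .W) none)))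

theorem leftWindow_eq (m n : ℕ) :
    leftWindow (m + 2) (m + 1 + n) =
      some true :: (List.replicate m (some true) ++ List.replicate n (some false)) := by
  rw [← List.cons_append, ← List.replicate_succ]
  apply List.ext_getElem
  · simp [leftWindow]
  · intro i h1 h2
    rw [List.getElem_append]
    simp only [leftWindow, List.getElem_map, List.getElem_range, List.getElem_replicate,
      List.length_replicate]
    split_ifs with h
    · rw [decide_eq_true (by omega)]
    · rw [decide_eq_false (by omega)]

theorem does_completeWindow (B cs : List (Option Bool)) (n : ℕ) :
    Does (M := M) completeWindow
      { inp := [], c := cs, B := B, P := B, L := List.replicate n (some false),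
        W := List.replicate n (some false) }
      { inp := [], B := B, P := B, L := leftWindow (cs.length + 2) (cs.length + 1 + n),
        W := none :: leftWindow (cs.length + 2) (cs.length + 1 + n) } (cs.length * 3 + 4) := by
  have := Does.loop (M := M) (k := .c) (dec := id)
    (q := fun _ => .seq (.push (.inr .L) (some true)) (.push (.inr .W) (some true)))
    (fun l₁ l₂ =>
      { inp := [], c := l₂, B := B, P := B,
        L := List.replicate l₁.length (some true) ++ List.replicate n (some false),
        W := List.replicate l₁.length (some true) ++ List.replicate n (some false) })
    (fun _ _ => rfl) (fun _ _ _ => (Does.push .L _).seq (Does.push .W _)) cs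
  rw [List.length_reverse] at this
  rw [leftWindow_eq]
  exact (this.seq ((Does.push .L _).seq ((Does.push .W _).seq (Does.push .W _)))).mono (by omega)

theorem length_vertices (p : ℕ) (l : List Bool) :
    (vertices p l).length = l.length + l.count true := by
  induction l generalizing p with
  | nil => rfl
  | cons x l ih => cases x <;> simp [vertices, ih] <;> omega

/-- Print the number of vertices. -/
def printOrder : GProg M :=
  .seq (.loop (.inr .B) id fun x => .seq (.push (.inr .B') x) <| .seq (.push (.inr .rev) true)
    (if x = some true then .push (.inr .rev) true else .skip)) <|
  .seq (.push (.inr .rev) false) (moveTo .B' .B id id)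

theorem does_printOrder (l : List Bool) (L W : List (Option Bool)) :
    Does (M := M) printOrder
      { inp := [], B := l.map some, P := l.map some, L := L, W := W }
      { inp := [], B := l.map some, P := l.map some, L := L, W := W,
        rev := (unary [(vertices 0 l).length]).reverse } (l.length * 6 + 3) := by
  have h1 := Does.loop (M := M) (k := .B) (dec := id)
    (q := fun x => .seq (.push (.inr .B') x) <| .seq (.push (.inr .rev) true)
      (if x = some true then .push (.inr .rev) true else .skip))
    (t := 1 + (1 + 1))
    (fun l₁ l₂ =>
      { inp := [], B := l₂, B' := l₁, P := l.map some, L := L, W := W,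
        rev := List.replicate (l₁.length + l₁.count (some true)) true }) (fun _ _ => rfl)
    (fun l₁ x l₂ => (Does.push .B' _).seq ((Does.push .rev _).seq (by
      by_cases hx : x = some true
      · rw [id, if_pos hx, hx, List.length_cons, List.count_cons_self]
        have : ∀ a b, List.replicate (a + 1 + (b + 1)) true =
            true :: true :: List.replicate (a + b) true := by
          intro a b
          rw [← List.replicate_succ, ← List.replicate_succ]
          congr 1
          omega
        rw [this]
        exact Does.push .rev _
      · rw [id, if_neg hx, List.length_cons, List.count_cons_of_ne hx, Nat.add_right_comm,
          List.replicate_succ]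
        exact Does.skip)))
    (l.map some)
  have h2 := Does.loop (M := M) (k := .B') (dec := id) (q := fun x => .push (.inr .B) x)
    (fun l₁ l₂ =>
      { inp := [], B := l₁, B' := l₂, P := l.map some, L := L, W := W,
        rev := false :: List.replicate (l.length + l.count true) true }) (fun _ _ => rfl)
    (fun _ _ _ => Does.push .B _) (l.map some).reverse
  rw [List.reverse_reverse] at h2
  have e : (l.map some).count (some true) = l.count true :=
    List.count_map_of_injective _ _ (Option.some_injective _) _
  rw [List.length_reverse, List.count_reverse, List.length_map, e] at h1
  have e' : (unary [(vertices 0 l).length]).reverse =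
      false :: List.replicate (l.length + l.count true) true := by
    simp [unary, length_vertices]
  rw [e']
  refine (h1.seq ((Does.push .rev _).seq h2)).mono ?_
  simp only [List.length_reverse, List.length_map]
  omega

/-- Print a fixed string. -/
def printString : List Bool → GProg M
  | [] => .skip
  | x :: s => .seq (.push (.inr .rev) x) (printString s)

theorem does_printString (s : List Bool) (m : Mem (M.Γ M.k₁)) :
    Does (printString s) m { m with rev := s.reverse ++ m.rev } (s.length + 1) := by
  induction s generalizing m with
  | nil => exact Does.skip
  | cons x s ih =>
    have := (Does.push (m := m) .rev x).seq (ih _)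
    rw [List.reverse_cons, List.append_assoc]
    exact this.mono (by rw [List.length_cons]; omega)

/-- Empty the work stacks, and reverse the output. -/
def finish : GProg M :=
  .seq (.loop (.inr .B) id fun _ => .skip) <| .seq (.loop (.inr .L) id fun _ => .skip) <|
  .seq (.loop (.inr .W) id fun _ => .skip)
    (.loop (.inr .rev) some fun x => .push (.inr .out) (x.getD false))

theorem does_finish (B L W : List (Option Bool)) (rev : List Bool) :
    Does (M := M) finish { inp := [], B := B, L := L, W := W, rev := rev }
      { inp := [], out := rev.reverse }
      (2 * (B.length + L.length + W.length + rev.length) + 4) := by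
  have h1 := Does.loop (M := M) (k := .B) (dec := id) (q := fun _ => .skip)
    (fun _ l₂ => { inp := [], B := l₂, L := L, W := W, rev := rev }) (fun _ _ => rfl)
    (fun _ _ _ => Does.skip) B
  have h2 := Does.loop (M := M) (k := .L) (dec := id) (q := fun _ => .skip)
    (fun _ l₂ => { inp := [], L := l₂, W := W, rev := rev }) (fun _ _ => rfl)
    (fun _ _ _ => Does.skip) L
  have h3 := Does.loop (M := M) (k := .W) (dec := id) (q := fun _ => .skip)
    (fun _ l₂ => { inp := [], W := l₂, rev := rev }) (fun _ _ => rfl)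
    (fun _ _ _ => Does.skip) W
  have h4 := Does.loop (M := M) (k := .rev) (dec := some)
    (q := fun x => .push (.inr .out) (x.getD false))
    (fun l₁ l₂ => { inp := [], rev := l₂, out := l₁ }) (fun _ _ => rfl)
    (fun _ _ _ => Does.push .out _) rev
  exact (h1.seq (h2.seq (h3.seq h4))).mono (by omega)

/-- The marks of the positions of the graph for a word. -/
def wordMarks (y : List Bool) : List Bool :=
  (columnBits y).flatMap (columnMarks (y.length + 2))

/-- What is printed for a word, apart from a fixed suffix. -/
def graphList (y : List Bool) : List ℕ :=
  (vertices 0 (wordMarks y)).length :: matrixFrom (y.length + 4) 0 (wordMarks y) (wordMarks y)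

/-- Print the graph for the word in the input, followed by a fixed string. -/
def printGraph (dec : M.Γ M.k₁ → Option Bool) (suffix : List Bool) : GProg M :=
  .seq (prepare dec) <| .seq pushColumns <| .seq completeWindow <| .seq printOrder <|
  .seq printMatrix <| .seq (printString suffix) finish

theorem length_wordMarks (y : List Bool) :
    (wordMarks y).length = (y.length + 2) * (y.length + 4) := by
  have : ∀ (m : ℕ) (w : List Bool), (w.flatMap (columnMarks m)).length = w.length * (m + 2) := by
    intro m w
    induction w with
    | nil => simp
    | cons x w ih => simp [ih, columnMarks]; ring
  rw [wordMarks, this]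
  simp [columnBits]

theorem length_unary (l : List ℕ) : (unary l).length = l.sum + l.length := by
  induction l with
  | nil => rfl
  | cons a l ih =>
    rw [unary, List.flatMap_cons, ← unary, List.length_append, ih]
    simp
    omega

theorem length_unary_graphList_le (y : List Bool) :
    (unary (graphList y)).length ≤ 11 * (wordMarks y).length ^ 2 := by
  have hN : (vertices 0 (wordMarks y)).length ≤ 2 * (wordMarks y).length := by
    rw [length_vertices]
    have := List.count_le_length (a := true) (l := wordMarks y)
    omega
  have h1 : (matrixFrom (y.length + 4) 0 (wordMarks y) (wordMarks y)).length =
      (vertices 0 (wordMarks y)).length * (vertices 0 (wordMarks y)).length := by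
    simp [matrixFrom, List.length_flatMap]
  have h2 : (matrixFrom (y.length + 4) 0 (wordMarks y) (wordMarks y)).sum ≤
      (vertices 0 (wordMarks y)).length * (vertices 0 (wordMarks y)).length := by
    rw [← h1]
    have := List.sum_le_card_nsmul (matrixFrom (y.length + 4) 0 (wordMarks y) (wordMarks y)) 1 (by
      intro a ha
      simp only [matrixFrom, List.mem_flatMap, List.mem_map] at ha
      obtain ⟨u, -, v, -, rfl⟩ := ha
      exact Bool.toNat_le _)
    simpa using this
  have h8 : 8 ≤ (wordMarks y).length := by
    rw [length_wordMarks]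
    nlinarith
  rw [length_unary, graphList, List.sum_cons, List.length_cons]
  nlinarith

theorem does_printGraph {dec : M.Γ M.k₁ → Option Bool} {enc : Bool → M.Γ M.k₁}
    (h : ∀ b, dec (enc b) = some b) (suffix y : List Bool) :
    Does (M := M) (printGraph dec suffix) { inp := y.map enc }
      { inp := [], out := unary (graphList y) ++ suffix }
      (100 * (wordMarks y).length ^ 2 + 3 * suffix.length) := by
  have hcs : ((columnBits y).map some).length = y.length + 2 := by simp [columnBits]
  have hcb : (columnBits y).length = y.length + 2 := by simp [columnBits]
  set cs := (columnBits y).map some with hcs'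
  have hlen := length_wordMarks y
  have hle := length_unary_graphList_le y
  have h2 := does_pushColumns (M := M) (columnBits y) cs
  have h3 := does_completeWindow (M := M) ((wordMarks y).map some) cs ((wordMarks y).length)
  have h4 := does_printOrder (M := M) (wordMarks y)
    (leftWindow (y.length + 4) (y.length + 3 + (wordMarks y).length))
    (none :: leftWindow (y.length + 4) (y.length + 3 + (wordMarks y).length))
  have h5 := does_printMatrix (M := M) (D := y.length + 4)
    (n := y.length + 3 + (wordMarks y).length) (by omega) (wordMarks y) (by omega)
    (wordMarks y) 0 (by omega) (unary [(vertices 0 (wordMarks y)).length]).reverse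
  have e : (unary (matrixFrom (y.length + 4) 0 (wordMarks y) (wordMarks y))).reverse ++
      (unary [(vertices 0 (wordMarks y)).length]).reverse = (unary (graphList y)).reverse := by
    rw [← List.reverse_append, ← unary_append]
    rfl
  rw [e] at h5
  have hW : (columnBits y).flatMap (columnMarks (y.length + 2)) = wordMarks y := rfl
  rw [hcs, hcb, hW, ← hlen] at h2
  rw [hcs] at h3
  have h6 := h4.seq (h5.seq ((does_printString suffix _).seq (does_finish _ _ _ _)))
  have h7 := (does_prepare h y).seq (h2.seq (h3.seq h6))
  rw [List.reverse_append, List.reverse_reverse, List.reverse_reverse] at h7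
  refine h7.mono ?_
  simp only [leftWindow, List.length_append, List.length_reverse, List.length_cons,
    List.length_drop, List.length_take, List.length_map, List.length_range]
  generalize (unary (graphList y)).length = U at *
  generalize (wordMarks y).length = N at *
  generalize y.length = z at *
  have hz : z + 4 ≤ N := by nlinarith
  have h8 : z * z ≤ N := by nlinarith
  have h9 : 8 * N ≤ N ^ 2 := by nlinarith
  rw [Nat.min_eq_left (by omega), Nat.add_sub_cancel]
  clear h2 h3 h4 h5 h6 h7
  nlinarith

end

/-! ### The graph of a word -/

theorem mem_vertices {p : ℕ} {l : List Bool} {q : ℕ} {κ : Bool} :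
    (q, κ) ∈ vertices p l ↔ p ≤ q ∧ q < p + l.length ∧ (κ = true → l[q - p]? = some true) := by
  induction l generalizing p with
  | nil => simp [vertices]; omega
  | cons x l ih =>
    have h1 : (q, κ) ∈ vertices p (x :: l) ↔
        (q = p ∧ (κ = true → x = true)) ∨ (q, κ) ∈ vertices (p + 1) l := by
      cases x <;> cases κ <;> simp [vertices]
    rw [h1, ih, List.length_cons]
    rcases lt_trichotomy q p with h | rfl | h
    · constructor
      · rintro (h' | h') <;> omega
      · intro h'; omega
    · simp
    · obtain ⟨j, rfl⟩ := Nat.exists_eq_add_of_lt h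
      have e : p + j + 1 - p = j + 1 := by omega
      have e' : p + j + 1 - (p + 1) = j := by omega
      rw [e, e', List.getElem?_cons_succ]
      constructor
      · rintro (h' | h')
        · omega
        · exact ⟨by omega, by omega, h'.2.2⟩
      · exact fun h' => .inr ⟨by omega, by omega, h'.2.2⟩

theorem nodup_vertices (p : ℕ) (l : List Bool) : (vertices p l).Nodup := by
  induction l generalizing p with
  | nil => exact List.nodup_nil
  | cons x l ih =>
    have h : ∀ κ, (p, κ) ∉ vertices (p + 1) l := by
      intro κ h
      have := (mem_vertices.1 h).1
      omega
    cases x <;> simp [vertices, ih, h]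

/-- Where the vertices of the graph of a word are placed. -/
def wordPos (y : List Bool) (v : Fin (vertices 0 (wordMarks y)).length) : ℕ :=
  ((vertices 0 (wordMarks y))[v]).1

/-- The graph of a word. Its positions form columns, one for each bit of the word and for the two
bits added at its ends; the first position of a column has two vertices if and only if its bit is
`true`. -/
def wordGraph (y : List Bool) : SimpleGraph (Fin (vertices 0 (wordMarks y)).length) :=
  nearGraph (y.length + 4) (wordPos y)

theorem adjBit_vertices {D : ℕ} {l : List Bool} (hD : 0 < D) (u v : Fin (vertices 0 l).length) :
    adjBit D (vertices 0 l)[u] (vertices 0 l)[v] = true ↔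
      (nearGraph D fun v : Fin (vertices 0 l).length => ((vertices 0 l)[v]).1).Adj u v := by
  have huv : u = v ↔ (vertices 0 l)[u] = (vertices 0 l)[v] := by
    rw [Fin.ext_iff]
    exact ((nodup_vertices 0 l).getElem_inj_iff).symm
  simp only [nearGraph, ne_eq, huv, Prod.ext_iff, adjBit, windowAt]
  generalize (vertices 0 l)[u] = a
  generalize (vertices 0 l)[v] = b
  obtain ⟨p, κ⟩ := a
  obtain ⟨q, κ'⟩ := b
  by_cases h : p = q
  · subst h
    simp [entry, hD]
  · simp [entry, h]

theorem graphCode_wordGraph (y : List Bool) : graphCode (wordGraph y) = graphList y := by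
  have key : ∀ {β : Type} (f : ℕ × Bool → β), (vertices 0 (wordMarks y)).map f =
      (List.finRange _).map fun i : Fin (vertices 0 (wordMarks y)).length =>
        f (vertices 0 (wordMarks y))[i] := by
    intro β f
    apply List.ext_getElem <;> simp
  rw [graphCode, graphList, matrixFrom, List.flatMap_def, List.flatMap_def, key]
  congr 3
  funext i
  rw [key]
  congr 1
  funext j
  have h := adjBit_vertices (D := y.length + 4) (by omega) i j
  by_cases hij : (wordGraph y).Adj i j
  · rw [if_pos hij, h.2 hij]
    rfl
  · rw [if_neg hij, Bool.eq_false_iff.2 fun h' => hij (h.1 h')]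
    rfl

theorem getElem?_flatMap_columnMarks (m : ℕ) (w : List Bool) (i : ℕ) :
    (w.flatMap (columnMarks m))[i * (m + 2)]? = w[i]? := by
  induction w generalizing i with
  | nil => rfl
  | cons x w ih =>
    have hx : (columnMarks m x).length = m + 2 := by simp [columnMarks]
    rw [List.flatMap_cons]
    cases i with
    | zero => simp [columnMarks]
    | succ i =>
      rw [Nat.succ_mul, List.getElem?_append_right (by omega), hx, Nat.add_sub_cancel, ih,
        List.getElem?_cons_succ]

theorem isLayout_wordPos (y : List Bool) :
    IsLayout (y.length + 4) (wordMarks y).length (fun q => (wordMarks y)[q]? = some true)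
      (wordPos y) := by
  have hmem : ∀ v : Fin (vertices 0 (wordMarks y)).length,
      (vertices 0 (wordMarks y))[v] ∈ vertices 0 (wordMarks y) := fun v => List.getElem_mem _
  have hex : ∀ u ∈ vertices 0 (wordMarks y), ∃ v : Fin (vertices 0 (wordMarks y)).length,
      (vertices 0 (wordMarks y))[v] = u := by
    intro u hu
    obtain ⟨i, hi, h⟩ := List.getElem_of_mem hu
    exact ⟨⟨i, hi⟩, h⟩
  refine ⟨by omega, ?_, fun v => ?_, fun q hq => ?_, fun v => ⟨fun h => ?_, ?_⟩, ?_, ?_⟩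
  · rw [length_wordMarks]
    exact Nat.mul_le_mul_right _ (by omega)
  · have := (mem_vertices.1 (hmem v)).2.1
    rwa [Nat.zero_add] at this
  · obtain ⟨v, hv⟩ := hex (q, false) (mem_vertices.2 ⟨by omega, by omega, by simp⟩)
    exact ⟨v, by rw [wordPos, hv]⟩
  · -- the other vertex at the position of `v`
    obtain ⟨u, hu⟩ := hex (wordPos y v, !((vertices 0 (wordMarks y))[v]).2)
      (mem_vertices.2 ⟨by omega, (mem_vertices.1 (hmem v)).2.1, fun _ => h⟩)
    refine ⟨u, ?_, by rw [wordPos, hu]⟩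
    rintro rfl
    have := congrArg Prod.snd hu
    simp at this
  · rintro ⟨u, huv, h⟩
    have hne : (vertices 0 (wordMarks y))[u] ≠ (vertices 0 (wordMarks y))[v] := fun h' =>
      huv (Fin.ext ((nodup_vertices 0 _).getElem_inj_iff.1 h'))
    have hu := (mem_vertices.1 (hmem u)).2.2
    have hv := (mem_vertices.1 (hmem v)).2.2
    rw [wordPos, wordPos] at h
    by_cases h' : ((vertices 0 (wordMarks y))[v]).2 = true
    · exact hv h'
    · rw [wordPos, ← h]
      refine hu ?_
      by_contra h''
      exact hne (Prod.ext h ((Bool.eq_false_iff.2 h'').trans (Bool.eq_false_iff.2 h').symm))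
  · rw [wordMarks, columnBits]
    rfl
  · rw [← List.getLast?_eq_getElem?, wordMarks, columnBits, List.flatMap_append]
    simp [columnMarks, List.getLast?_append, List.getLast?_cons, List.replicate_succ]
    cases y.length <;> simp [List.getLast?_replicate]

/-- One sentence decides for all circuits, from the graphs of their codes, weighted
satisfiability. -/
theorem exists_sentence_hasSatWeight : ∃ φ : MSO₁Sentence, ∀ (C : Circuit) (k : ℕ),
    Models (wordGraph (unary (k :: C.code))) φ ↔ C.HasSatWeight k := by
  obtain ⟨φ, hφ⟩ := sweepConstraints.exists_sentence
  refine ⟨φ, fun C k => ?_⟩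
  set y := unary (k :: C.code) with hy
  rw [wordGraph, hφ _ _ _ _ _ (isLayout_wordPos y), ← C.exists_accepts_iff k, ← hy]
  have hlen : (wordMarks y).length = ((y ++ [false]).length + 1) * (y.length + 4) := by
    rw [length_wordMarks]
    simp
  rw [hlen]
  refine exists_valid_sweepConstraints_iff (by simp) (fun i hi => ?_) (by simp)
  rw [wordMarks, getElem?_flatMap_columnMarks, columnBits, List.cons_append,
    List.getElem?_cons_succ, List.getElem?_eq_getElem hi, Option.some_inj]

/-! ### The composed reduction -/

/-- A machine that writes `y` can be turned into one that writes the graph of `y` instead, followed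
by a fixed string. -/
theorem exists_progMachine_outputs (M : TM2ComputableAux Bool Bool) (suffix : List Bool) :
    ∃ M' : TM2ComputableAux Bool Bool, ∀ (x y : List Bool) (t : ℕ),
      Nonempty (TM2OutputsInTime M.tm (x.map M.inputAlphabet.invFun)
        (some (y.map M.outputAlphabet.invFun)) t) →
      Nonempty (TM2OutputsInTime M'.tm (x.map M'.inputAlphabet.invFun)
        (some ((unary (graphList y) ++ suffix).map M'.outputAlphabet.invFun))
        (t + (100 * (wordMarks y).length ^ 2 + 3 * suffix.length) + 1)) := by
  refine ⟨⟨progMachine M.tm (printGraph (fun a => some (M.outputAlphabet a)) suffix) .out,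
    M.inputAlphabet, Equiv.refl Bool⟩, ?_⟩
  rintro x y t ⟨h⟩
  obtain ⟨t', ht', h'⟩ := does_printGraph (M := M.tm) (dec := fun a => some (M.outputAlphabet a))
    (enc := M.outputAlphabet.invFun) (fun b => congrArg some (M.outputAlphabet.right_inv b))
    suffix y
  have e1 : memStacks (M := M.tm) { inp := y.map M.outputAlphabet.invFun } =
      joinStacks (haltStacks M.tm (y.map M.outputAlphabet.invFun)) fun _ => [] := by
    refine congrArg (joinStacks _) (funext fun k => ?_)
    cases k <;> rfl
  have e2 : memStacks (M := M.tm) { inp := [], out := unary (graphList y) ++ suffix } =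
      joinStacks (fun _ => [])
        (update (fun _ => []) Stk.out (unary (graphList y) ++ suffix)) := by
    refine congrArg₂ joinStacks (funext fun k => ?_) (funext fun k => ?_)
    · by_cases hk : k = M.tm.k₁
      · subst hk
        exact dif_pos rfl
      · exact dif_neg hk
    · cases k <;> rfl
  rw [e1, e2] at h'
  have e3 : (unary (graphList y) ++ suffix).map (Equiv.refl Bool).invFun =
    unary (graphList y) ++ suffix := List.map_id _
  rw [← e3] at h'
  obtain ⟨⟨h1, h2⟩⟩ := progMachine_outputsInTime M.tm _ Stk.out _ _ _ h h'
  exact ⟨⟨h1, h2.trans (by omega)⟩⟩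

/-- The time bound of the composed reduction, in terms of the bound of the first reduction. -/
theorem composed_time_le {b K t z c v n N : ℕ} (ht : t = v * (n + 1) ^ c) (hz : z ≤ n + b * t)
    (hN : N = (z + 2) * (z + 4)) :
    t + (100 * N ^ 2 + 3 * K) + 1 ≤
      (v + (100 * (b * v + 4) ^ 4 + (3 * K + 1))) * (n + 1) ^ (4 * (c + 1)) := by
  have h1 : (n + 1) ^ c ≤ (n + 1) ^ (c + 1) := Nat.pow_le_pow_right (by omega) (by omega)
  have h2 : n + 1 ≤ (n + 1) ^ (c + 1) := Nat.le_self_pow (by omega) _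
  have h3 : z + 4 ≤ (b * v + 4) * (n + 1) ^ (c + 1) := by
    have : b * t ≤ b * v * (n + 1) ^ (c + 1) := by
      rw [ht, ← mul_assoc]
      exact Nat.mul_le_mul_left _ h1
    rw [add_mul]
    omega
  have h4 : N ^ 2 ≤ (b * v + 4) ^ 4 * (n + 1) ^ (4 * (c + 1)) := by
    have h5 : N ≤ (z + 4) ^ 2 := by rw [hN]; nlinarith
    calc N ^ 2 ≤ ((z + 4) ^ 2) ^ 2 := Nat.pow_le_pow_left h5 2
      _ = (z + 4) ^ 4 := by rw [← pow_mul]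
      _ ≤ ((b * v + 4) * (n + 1) ^ (c + 1)) ^ 4 := Nat.pow_le_pow_left h3 4
      _ = _ := by rw [mul_pow, ← pow_mul, mul_comm (c + 1)]
  have h6 : t ≤ v * (n + 1) ^ (4 * (c + 1)) := by
    rw [ht]
    exact Nat.mul_le_mul_left _ (Nat.pow_le_pow_right (by omega) (by omega))
  have h7 : 1 ≤ (n + 1) ^ (4 * (c + 1)) := Nat.one_le_pow _ _ (by omega)
  have h8 := Nat.mul_le_mul_left (3 * K + 1) h7
  rw [add_mul, add_mul, mul_assoc 100]
  omega

theorem computable_timeBound {f : ℕ → ℕ} (hf : Computable f) (b K : ℕ) :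
    Computable fun k => f k + (100 * (b * f k + 4) ^ 4 + K) := by
  have h1 : Primrec fun v : ℕ => b * v + 4 :=
    Primrec.nat_add.comp (Primrec.nat_mul.comp (Primrec.const b) Primrec.id) (Primrec.const 4)
  have h2 : Primrec fun v : ℕ => (b * v + 4) * (b * v + 4) := Primrec.nat_mul.comp h1 h1
  have h3 := Primrec.nat_mul.comp h2 h2
  have h4 := Primrec.nat_add.comp Primrec.id (Primrec.nat_add.comp
    (Primrec.nat_mul.comp (Primrec.const 100) h3) (Primrec.const K))
  refine (h4.to_comp.comp hf).of_eq fun k => ?_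
  simp only [id]
  ring

theorem wHard_mso₁ModelChecking_unitIntervalGraphs :
    WHard 2 (MSO₁ModelChecking unitIntervalGraphs) := by
  obtain ⟨φ, hφ⟩ := exists_sentence_hasSatWeight
  rintro Q ⟨h, r, M, f, g, c, hf, -, hM, -, hr⟩
  obtain ⟨b, hb⟩ := exists_length_output_le M.tm
  obtain ⟨M', hM'⟩ := exists_progMachine_outputs M (unary φ.code)
  refine ⟨fun x => ⟨_, wordGraph ((WCS 2 h).encode (r x)),
      isUnitIntervalGraph_nearGraph (Nat.succ_pos _) _, φ⟩, M', _, fun _ => φ.length, 4 * (c + 1),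
    computable_timeBound hf b (3 * (unary φ.code).length + 1), Computable.const _, fun x => ?_,
    fun x => le_rfl, fun x => (hr x).trans (hφ _ _).symm⟩
  have e : (MSO₁ModelChecking unitIntervalGraphs).encode
      ⟨_, wordGraph ((WCS 2 h).encode (r x)), isUnitIntervalGraph_nearGraph (Nat.succ_pos _) _, φ⟩ =
      unary (graphList ((WCS 2 h).encode (r x))) ++ unary φ.code := by
    rw [← graphCode_wordGraph, ← unary_append]
    rfl
  obtain ⟨h1, h2⟩ := hM' _ _ _ (hM x)
  rw [e]
  refine ⟨⟨h1, h2.trans (composed_time_le rfl ?_ (length_wordMarks _))⟩⟩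
  simpa using hb _ _ _ (hM x)

end ParamComplexity

theorem mainTheorem5 :
    ParamComplexity.WHard 2
      (ParamComplexity.MSO₁ModelChecking ParamComplexity.unitIntervalGraphs) :=
  ParamComplexity.wHard_mso₁ModelChecking_unitIntervalGraphs
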